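/- A \emph{non-ambiguous tree} is a filling of a rectangular grid in which each cell is dotted or not, such that every row and every column contains a dotted cell, and every dotted cell other than the top-left cell has either a dotted cell above it in its column or a dotted cell to its left in its row, but not both. It is \emph{complete} (a CNAT) if every dot either has both a dot below it in its column and a dot to its right in its row, or has neither; in the latter case the dot is called a \emph{leaf}. For a permutation $\pi=\pi_1\cdots\pi_n$, a \emph{CNAT of $\pi$} is a CNAT on the $n\times n$ grid whose set of leaves is the set of cells in column $i$ and row $\pi_i$ for $1\le i\le n$ (columns numbered from left to right, rows from top to bottom). The permutation $\pi$ is \emph{irreducible} if for no $1\le k<n$ is $\pi_1\cdots\pi_k$ a permutation of $\{1,\dots,k\}$. An \emph{occurrence} in $\pi$ of a pattern $\tau=\tau_1\cdots\tau_k$ is a choice of indices $i_1<\cdots<i_k$ such that $\pi_{i_1},\dots,\pi_{i_k}$ are in the same relative order as $\tau_1,\dots,\tau_k$; $\pi$ \emph{avoids} $\tau$ if there is none. \textbf{Proposition.} Let $\pi$ be an irreducible permutation. Then $\pi$ has exactly $2$ CNATs if and only if $\pi$ contains exactly one occurrence of the pattern $321$ and avoids the pattern $3412$. Moreover, if $\pi_i,\pi_j,\pi_k$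 with $i<j<k$ is the unique occurrence of $321$ in $\pi$, then $\pi_j=j$, and $j$ is the unique fixed point of $\pi$. -/

import Mathlib

/-- An `n`-permutation `π` (in one-line notation `π 0, π 1, …`, indexed from `0`) is reducible if
for some `1 ≤ k < n` its first `k` letters form a permutation of the first `k` letters. As these
letters are distinct, this means that they all lie among the first `k` letters. -/
def PermReducible {n : ℕ} (π : Equiv.Perm (Fin n)) : Prop :=
  ∃ k : ℕ, 1 ≤ k ∧ k < n ∧ ∀ i : Fin n, (i : ℕ) < k → (π i : ℕ) < k

/-- A permutation is irreducible if it is not reducible. -/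
def PermIrreducible {n : ℕ} (π : Equiv.Perm (Fin n)) : Prop :=
  ¬ PermReducible π

/-- The positions `f 0 < f 1 < ⋯ < f (k - 1)` give an occurrence in `π` of the pattern `τ`, a word
of `k` distinct letters: the letters of `π` at these positions are in the same relative order
as those of `τ`. -/
def IsPatternOccurrence {n k : ℕ} (π : Equiv.Perm (Fin n)) (τ : Fin k → ℕ)
    (f : Fin k ↪o Fin n) : Prop :=
  ∀ a b : Fin k, π (f a) < π (f b) ↔ τ a < τ b

/-- `π` avoids the pattern `τ` if `τ` has no occurrence in `π`. -/
def AvoidsPattern {n k : ℕ} (π : Equiv.Perm (Fin n)) (τ : Fin k → ℕ) : Prop :=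
  ¬ ∃ f : Fin k ↪o Fin n, IsPatternOccurrence π τ f

/-- A filling of a grid with `m` rows and `n` columns is given by its set of dotted cells.
The cell `(c, r)` lies in column `c` and row `r`; columns are numbered from left to right and rows
from top to bottom. -/
abbrev GridFilling (m n : ℕ) : Type := Finset (Fin n × Fin m)

namespace GridFilling

variable {m n : ℕ}

/-- There is a dotted cell above the cell `d`, in the same column. -/
def HasDotAbove (T : GridFilling m n) (d : Fin n × Fin m) : Prop :=
  ∃ r : Fin m, r < d.2 ∧ (d.1, r) ∈ T

/-- There is a dotted cell to the left of the cell `d`, in the same row. -/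
def HasDotLeft (T : GridFilling m n) (d : Fin n × Fin m) : Prop :=
  ∃ c : Fin n, c < d.1 ∧ (c, d.2) ∈ T

/-- There is a dotted cell below the cell `d`, in the same column. -/
def HasDotBelow (T : GridFilling m n) (d : Fin n × Fin m) : Prop :=
  ∃ r : Fin m, d.2 < r ∧ (d.1, r) ∈ T

/-- There is a dotted cell to the right of the cell `d`, in the same row. -/
def HasDotRight (T : GridFilling m n) (d : Fin n × Fin m) : Prop :=
  ∃ c : Fin n, d.1 < c ∧ (c, d.2) ∈ T

/-- Non-ambiguous trees. -/
structure IsNAT (T : GridFilling m n) : Prop where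
  /-- Every row contains a dotted cell. -/
  row_nonempty : ∀ r : Fin m, ∃ c : Fin n, (c, r) ∈ T
  /-- Every column contains a dotted cell. -/
  col_nonempty : ∀ c : Fin n, ∃ r : Fin m, (c, r) ∈ T
  /-- Every dotted cell other than the top-left one has either a dotted cell above it or a dotted
  cell to its left, but not both. -/
  unique_parent : ∀ d ∈ T, ¬ ((d.1 : ℕ) = 0 ∧ (d.2 : ℕ) = 0) →
    Xor (T.HasDotAbove d) (T.HasDotLeft d)

/-- Complete non-ambiguous trees: every dot has both a dot below it and a dot to its right, or
neither of these. -/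
structure IsCNAT (T : GridFilling m n) : Prop extends IsNAT T where
  complete : ∀ d ∈ T, (T.HasDotBelow d ∧ T.HasDotRight d) ∨ (¬ T.HasDotBelow d ∧ ¬ T.HasDotRight d)

/-- The leaf dots: dots with no dot below them and no dot to their right. -/
def IsLeaf (T : GridFilling m n) (d : Fin n × Fin m) : Prop :=
  d ∈ T ∧ ¬ T.HasDotBelow d ∧ ¬ T.HasDotRight d

end GridFilling

/-- The set of complete non-ambiguous trees with associated permutation `π`: those whose leaf dots
form the graphical representation of `π`, which has its dots in column `i` and row `π i`. -/
def cnatSet {n : ℕ} (π : Equiv.Perm (Fin n)) : Set (GridFilling n n) :=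
  {T | T.IsCNAT ∧ ∀ d : Fin n × Fin n, T.IsLeaf d ↔ d.2 = π d.1}

/-- The number of complete non-ambiguous trees with associated permutation `π`. -/
noncomputable def cnat {n : ℕ} (π : Equiv.Perm (Fin n)) : ℕ :=
  (cnatSet π).ncard

/-! Name the dot in the column of leaf `i` and the row of leaf `j` by the pair `(i, j)`. A dot other
than a leaf is then an inversion, so a CNAT becomes a tree carried by the inversion graph of the
permutation. The definition makes sense on any finite vertex set `S` with position `q` and value
`p`; let t(S) be the number of such trees. The root is `(a, b)`, with `a` leftmost and `b` of
smallest value. Removing it splits `S` into the vertices of the two subtrees, whence t(S) = ∑ t(A)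
t(S \ A) over the sets A that contain `a` but not `b` (`treeCount_eq_sum`).

Inductions along this recursion show that t(S) is positive exactly when the inversion graph on `S`
is connected, that a new vertex with one neighbour leaves t unchanged
(`treeCount_insert_of_unique_adj`), and that a new vertex with at least two neighbours in a
connected set strictly increases t (`treeCount_lt_insert`). A connected set can be grown from any
nonempty subset by adding vertices adjacent to what is already there, so t is monotone along such
growth.

Irreducibility gives connectedness. The pattern 321 is a triangle, with t = 2; the pattern 3412 is a
4-cycle, with t at least 3. Without 3412, a vertex in no triangle has at most one neighbour in a
connected set avoiding it (`eq_of_adj_of_adj`). Hence t = 1 without triangles, and growth from a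
unique triangle keeps t = 2. Conversely, if t = 2 then 3412 is excluded, a triangle exists, and in
growing from it every later vertex has one neighbour and creates no second triangle
(`is321_unique`).

For fixed points: a letter is fixed exactly when the larger letters to its left are as many as the
smaller ones to its right. The middle of a unique 321 has one of each. In an irreducible permutation
of length at least 2 a fixed letter cannot have none, so it is the middle of a 321. -/

/-- Two vertices are adjacent in the inversion graph if their positions `q` and their values `p`
are in opposite order. -/
def InvAdj {V : Type*} (q p : V → ℕ) (x y : V) : Prop :=
  (q x < q y ∧ p y < p x) ∨ (q y < q x ∧ p x < p y)

/-- The inversion graph induced on `S` is connected: every cut is crossed by an edge. -/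
def CutConnected {V : Type*} (q p : V → ℕ) (S : Finset V) : Prop :=
  ∀ X ⊆ S, X.Nonempty → X ≠ S → ∃ x ∈ X, ∃ y ∈ S, y ∉ X ∧ InvAdj q p x y

/-- Complete non-ambiguous trees on a vertex set `S`: the pair `(i, j)` stands for the dot in the
column of `i` and the row of `j`, so that the pairs `(i, i)` are the leaves. -/
structure IsTreeOn {V : Type*} (q p : V → ℕ) (S : Finset V) (T : Finset (V × V)) : Prop where
  fst_mem : ∀ {i j}, (i, j) ∈ T → i ∈ S
  snd_mem : ∀ {i j}, (i, j) ∈ T → j ∈ S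
  pos_le : ∀ {i j}, (i, j) ∈ T → q i ≤ q j
  val_le : ∀ {i j}, (i, j) ∈ T → p j ≤ p i
  leaf_mem : ∀ {i}, i ∈ S → (i, i) ∈ T
  parent : ∀ {i j}, (i, j) ∈ T → ¬ ((∀ x ∈ S, q i ≤ q x) ∧ ∀ x ∈ S, p j ≤ p x) →
    Xor (∃ k, p k < p j ∧ (i, k) ∈ T) (∃ k, q k < q i ∧ (k, j) ∈ T)

open Classical in
/-- The finite set of complete non-ambiguous trees on `S`. -/
noncomputable def treesOn {V : Type*} (q p : V → ℕ) (S : Finset V) : Finset (Finset (V × V)) :=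
  (S ×ˢ S).powerset.filter (IsTreeOn q p S)

/-- The number of complete non-ambiguous trees on `S`. -/
noncomputable def treeCount {V : Type*} (q p : V → ℕ) (S : Finset V) : ℕ :=
  (treesOn q p S).card

theorem Xor.of_iff {a b c d : Prop} (h : Xor a b) (hc : c ↔ a) (hd : d ↔ b) : Xor c d := by
  rwa [hc, hd]

theorem Xor.not_both {a b : Prop} (h : Xor a b) (ha : a) (hb : b) : False :=
  h.elim (fun h => h.2 hb) fun h => h.2 ha

/-! ### Trees on a vertex set and their connectedness -/

section

variable {V : Type*} {q p : V → ℕ} {S : Finset V} {T : Finset (V × V)}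

theorem mem_treesOn : T ∈ treesOn q p S ↔ IsTreeOn q p S T := by
  classical
  simp only [treesOn, Finset.mem_filter, Finset.mem_powerset, and_iff_right_iff_imp]
  intro h d hd
  exact Finset.mem_product.2 ⟨h.fst_mem hd, h.snd_mem hd⟩

theorem InvAdj.symm {x y : V} (h : InvAdj q p x y) : InvAdj q p y x := Or.symm h

theorem InvAdj.swap {x y : V} (h : InvAdj q p x y) : InvAdj p q x y := by
  rcases h with h | h
  · exact Or.inr ⟨h.2, h.1⟩
  · exact Or.inl ⟨h.2, h.1⟩

theorem InvAdj.ne {x y : V} (h : InvAdj q p x y) : x ≠ y := by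
  rintro rfl
  rcases h with h | h <;> exact lt_irrefl _ h.1

theorem IsTreeOn.adj (hq : q.Injective) (hp : p.Injective) (h : IsTreeOn q p S T) {i j : V}
    (hij : (i, j) ∈ T) (hne : i ≠ j) : InvAdj q p i j :=
  Or.inl ⟨lt_of_le_of_ne (h.pos_le hij) (hq.ne hne), lt_of_le_of_ne (h.val_le hij) (hp.ne hne.symm)⟩

/-- A set of vertices that no dot leaves contains with one vertex all those of the tree. -/
theorem IsTreeOn.side_const (hq : q.Injective) (hp : p.Injective) (h : IsTreeOn q p S T)
    (P : V → Prop) (hP : ∀ {i j}, (i, j) ∈ T → (P i ↔ P j)) {a b : V}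
    (ha : a ∈ S) (hamin : ∀ x ∈ S, q a ≤ q x) (hbmin : ∀ x ∈ S, p b ≤ p x) (hb : b ∈ S) :
    (∀ x ∈ S, (P x ↔ P a)) ∧ (a, b) ∈ T := by
  -- Passing to the parent lowers either `q i` or `p j`, so every dot is linked to the root by steps
  -- along which `P` is constant.
  have key : ∀ N : ℕ, ∀ i j, q i + p j ≤ N → (i, j) ∈ T → (P i ↔ P a) ∧ (a, b) ∈ T := by
    intro N
    induction N with
    | zero =>
      intro i j hN hij
      have h1 : i = a := hq (by have := hamin i (h.fst_mem hij); omega)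
      have h2 : j = b := hp (by have := hbmin j (h.snd_mem hij); omega)
      subst h1 h2
      exact ⟨Iff.rfl, hij⟩
    | succ N ih =>
      intro i j hN hij
      by_cases hroot : (∀ x ∈ S, q i ≤ q x) ∧ ∀ x ∈ S, p j ≤ p x
      · have h1 : i = a := hq (le_antisymm (hroot.1 a ha) (hamin i (h.fst_mem hij)))
        have h2 : j = b := hp (le_antisymm (hroot.2 b hb) (hbmin j (h.snd_mem hij)))
        subst h1 h2
        exact ⟨Iff.rfl, hij⟩
      · rcases (h.parent hij hroot).or with ⟨k, hk, hik⟩ | ⟨k, hk, hik⟩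
        · exact ih i k (by omega) hik
        · have := ih k j (by omega) hik
          exact ⟨((hP hij).trans (hP hik).symm).trans this.1, this.2⟩
  exact ⟨fun x hx => (key _ x x le_rfl (h.leaf_mem hx)).1, (key _ a a le_rfl (h.leaf_mem ha)).2⟩

/-- Every dot `(i, j)` with `i ≠ j` is an edge, so no dot crosses a cut that has no crossing edge;
`side_const` then puts all vertices on one side. -/
theorem IsTreeOn.cutConnected (hq : q.Injective) (hp : p.Injective) (h : IsTreeOn q p S T) :
    CutConnected q p S := by
  intro X hXS hX hne
  by_contra! hcon
  have hS : S.Nonempty := hX.mono hXS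
  obtain ⟨a, ha, hamin⟩ := S.exists_min_image q hS
  obtain ⟨b, hb, hbmin⟩ := S.exists_min_image p hS
  have := (h.side_const hq hp (· ∈ X) (fun {i j} hij => by
    by_cases hij' : i = j
    · rw [hij']
    · have hadj := h.adj hq hp hij hij'
      constructor
      · intro hi
        by_contra hj
        exact hcon i hi j (h.snd_mem hij) hj hadj
      · intro hj
        by_contra hi
        exact hcon j hj i (h.fst_mem hij) hi hadj.symm) ha hamin hbmin hb).1
  obtain ⟨x, hx⟩ := hX
  apply hne
  apply Finset.Subset.antisymm hXS
  intro y hy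
  exact (this y hy).2 ((this x (hXS hx)).1 hx)

theorem treeCount_eq_zero (hq : q.Injective) (hp : p.Injective) (h : ¬ CutConnected q p S) :
    treeCount q p S = 0 := by
  rw [treeCount, Finset.card_eq_zero, Finset.eq_empty_iff_forall_notMem]
  intro T hT
  exact h ((mem_treesOn.1 hT).cutConnected hq hp)

theorem cutConnected_of_treeCount_pos (hq : q.Injective) (hp : p.Injective)
    (h : 0 < treeCount q p S) : CutConnected q p S := by
  by_contra hc
  rw [treeCount_eq_zero hq hp hc] at h
  exact lt_irrefl _ h

theorem treeCount_empty : treeCount q p (∅ : Finset V) = 1 := by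
  rw [treeCount, Finset.card_eq_one]
  refine ⟨∅, Finset.ext fun T => ?_⟩
  rw [mem_treesOn, Finset.mem_singleton]
  constructor
  · intro h
    rw [Finset.eq_empty_iff_forall_notMem]
    rintro ⟨i, j⟩ hij
    exact absurd (h.fst_mem hij) (Finset.notMem_empty i)
  · rintro rfl
    constructor <;> simp

theorem treeCount_singleton (x : V) : treeCount q p {x} = 1 := by
  rw [treeCount, Finset.card_eq_one]
  refine ⟨{(x, x)}, Finset.ext fun T => ?_⟩
  rw [mem_treesOn, Finset.mem_singleton]
  constructor
  · intro h
    apply Finset.Subset.antisymm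
    · rintro ⟨i, j⟩ hij
      have h1 := Finset.mem_singleton.1 (h.fst_mem hij)
      have h2 := Finset.mem_singleton.1 (h.snd_mem hij)
      simp [h1, h2]
    · rw [Finset.singleton_subset_iff]
      exact h.leaf_mem (Finset.mem_singleton_self x)
  · rintro rfl
    constructor <;> simp +contextual

/-! ### Splitting at the root and the recursion -/

/-- The dots of `T` that lie below the root dot `(a, b)` in the binary tree, that is, in its left
subtree. -/
inductive LeftDot (q p : V → ℕ) (T : Finset (V × V)) (a b : V) : V → V → Prop
  | base {j : V} : (a, j) ∈ T → j ≠ b → LeftDot q p T a b a j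
  | down {i j k : V} : LeftDot q p T a b i j → (i, k) ∈ T → p j < p k → LeftDot q p T a b i k
  | right {i j k : V} : LeftDot q p T a b i j → (k, j) ∈ T → q i < q k → LeftDot q p T a b k j

variable {a b : V}

theorem LeftDot.mem {i j : V} (h : LeftDot q p T a b i j) : (i, j) ∈ T := by
  cases h <;> assumption

/-- The subtree is generated by steps down and to the right. Since a dot cannot have dots both above
it and to its left, steps up or to the left do not leave the subtree except into the root. The last
clause remembers the dot of column `a` from which the descent began. -/
theorem LeftDot.facts (hq : q.Injective) (hp : p.Injective) (h : IsTreeOn q p S T)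
    (hamin : ∀ x ∈ S, q a ≤ q x) (hb : b ∈ S) (hbmin : ∀ x ∈ S, p b ≤ p x)
    {i j : V} (hij : LeftDot q p T a b i j) :
    j ≠ b ∧ (∀ k, (i, k) ∈ T → p k < p j → (i, k) ≠ (a, b) → LeftDot q p T a b i k) ∧
    (∀ k, (k, j) ∈ T → q k < q i → LeftDot q p T a b k j) ∧
    ∃ k, (a, k) ∈ T ∧ k ≠ b ∧ p k ≤ p j := by
  induction hij with
  | @base j hj hjb =>
    refine ⟨hjb, fun k hk _ hne => .base hk (by rintro rfl; exact hne rfl), fun k hk hlt => ?_,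
      j, hj, hjb, le_rfl⟩
    have := hamin k (h.fst_mem hk)
    omega
  | @down i j k hij hk hlt ih =>
    obtain ⟨h1, h2, h3, l, h4, h5, h6⟩ := ih
    have hkb : k ≠ b := by
      rintro rfl
      have := hbmin j (h.snd_mem hij.mem)
      omega
    refine ⟨hkb, fun m hm hmk hne => ?_, fun m hm hmi => ?_, l, h4, h5, by omega⟩
    · rcases lt_trichotomy (p m) (p j) with h' | h' | h'
      · exact h2 m hm h' hne
      · rw [hp h']; exact hij
      · exact .down hij hm h'
    · have hx := h.parent hk (fun hr => hkb (hp (le_antisymm (hr.2 b hb)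
        (hbmin k (h.snd_mem hk)))))
      exact (hx.not_both ⟨j, hlt, hij.mem⟩ ⟨m, hmi, hm⟩).elim
  | @right i j k hij hk hlt ih =>
    obtain ⟨h1, h2, h3, h4⟩ := ih
    refine ⟨h1, fun m hm hmk hne => ?_, fun m hm hmi => ?_, h4⟩
    · have hx := h.parent hk (fun hr => h1 (hp (le_antisymm (hr.2 b hb)
        (hbmin j (h.snd_mem hk)))))
      exact (hx.not_both ⟨m, hmk, hm⟩ ⟨i, hlt, hij.mem⟩).elim
    · rcases lt_trichotomy (q m) (q i) with h' | h' | h'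
      · exact h3 m hm h'
      · rw [hq h']; exact hij
      · exact .right hij hm h'

/-- Removing the root dot splits a tree into two trees. -/
theorem IsTreeOn.exists_split [DecidableEq V] (hq : q.Injective) (hp : p.Injective)
    (h : IsTreeOn q p S T)
    (ha : a ∈ S) (hamin : ∀ x ∈ S, q a ≤ q x) (hb : b ∈ S) (hbmin : ∀ x ∈ S, p b ≤ p x)
    (hab : a ≠ b) :
    ∃ A ⊆ S, a ∈ A ∧ b ∉ A ∧ ∃ T₁ T₂, IsTreeOn q p A T₁ ∧ IsTreeOn q p (S \ A) T₂ ∧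
      T = insert (a, b) (T₁ ∪ T₂) := by
  classical
  have hroot : (a, b) ∈ T := (h.side_const hq hp (fun _ => True) (fun _ => Iff.rfl) ha hamin hbmin
    hb).2
  have facts := fun {i j : V} (hij : LeftDot q p T a b i j) =>
    LeftDot.facts hq hp h hamin hb hbmin hij
  -- Away from the root, all dots of one column or one row lie in the same subtree as the leaf
  -- there. The subtrees are thus determined by a set of vertices.
  have hleft : ∀ {i j}, (i, j) ∈ T → (i, j) ≠ (a, b) →
      (LeftDot q p T a b i j ↔ LeftDot q p T a b i i) := by
    intro i j hij hne
    rcases eq_or_ne i j with rfl | hne'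
    · rfl
    have hlt : p j < p i := lt_of_le_of_ne (h.val_le hij) (hp.ne hne'.symm)
    exact ⟨fun hl => .down hl (h.leaf_mem (h.fst_mem hij)) hlt,
      fun hl => (facts hl).2.1 j hij hlt hne⟩
  have hright : ∀ {i j}, (i, j) ∈ T →
      (LeftDot q p T a b i j ↔ LeftDot q p T a b j j) := by
    intro i j hij
    rcases eq_or_ne i j with rfl | hne'
    · rfl
    have hlt : q i < q j := lt_of_le_of_ne (h.pos_le hij) (hq.ne hne')
    exact ⟨fun hl => .right hl (h.leaf_mem (h.snd_mem hij)) hlt,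
      fun hl => (facts hl).2.2.1 i hij hlt⟩
  have hside : ∀ {i j}, (i, j) ∈ T → (i, j) ≠ (a, b) →
      (LeftDot q p T a b i i ↔ LeftDot q p T a b j j) := fun hij hne =>
    (hleft hij hne).symm.trans (hright hij)
  have haL : LeftDot q p T a b a a := .base (h.leaf_mem ha) hab
  have hbL : ¬ LeftDot q p T a b b b := fun hl => (facts hl).1 rfl
  -- every dot of the right subtree lies weakly to the right of a dot of the right subtree in row b
  have hR : ∀ N : ℕ, ∀ i j, q i + p j ≤ N → (i, j) ∈ T → (i, j) ≠ (a, b) →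
      ¬ LeftDot q p T a b i j → ∃ k, (k, b) ∈ T ∧ k ≠ a ∧ q k ≤ q i := by
    intro N
    induction N using Nat.strong_induction_on with
    | _ N ih =>
    intro i j hN hij hne hnl
    have hnr : ¬ ((∀ x ∈ S, q i ≤ q x) ∧ ∀ x ∈ S, p j ≤ p x) := fun hr => hne (by
      rw [hq (le_antisymm (hr.1 a ha) (hamin i (h.fst_mem hij))),
        hp (le_antisymm (hr.2 b hb) (hbmin j (h.snd_mem hij)))])
    rcases (h.parent hij hnr).or with ⟨k, hk, hik⟩ | ⟨k, hk, hkj⟩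
    · by_cases hkr : (i, k) = (a, b)
      · obtain ⟨rfl, rfl⟩ := Prod.mk.inj hkr
        exact absurd (.base hij (by rintro rfl; exact hne rfl)) hnl
      · exact ih (q i + p k) (by omega) i k le_rfl hik hkr (fun hl => hnl (.down hl hij hk))
    · by_cases hkr : (k, j) = (a, b)
      · obtain ⟨rfl, rfl⟩ := Prod.mk.inj hkr
        exact ⟨i, hij, by rintro rfl; exact hne rfl, le_rfl⟩
      · obtain ⟨l, h1, h2, h3⟩ := ih (q k + p j) (by omega) k j le_rfl hkj hkr
          (fun hl => hnl (.right hl hij hk))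
        exact ⟨l, h1, h2, by omega⟩
  set A := S.filter (fun x => LeftDot q p T a b x x) with hA
  have hmA : ∀ {x}, x ∈ S → (x ∈ A ↔ LeftDot q p T a b x x) := fun hx => by simp [hA, hx]
  refine ⟨A, Finset.filter_subset _ _, (hmA ha).2 haL, fun hbA => hbL ((hmA hb).1 hbA),
    T.filter (fun d => d.1 ∈ A ∧ d.2 ∈ A), T.filter (fun d => d.1 ∈ S \ A ∧ d.2 ∈ S \ A),
    ?_, ?_, ?_⟩
  · have mem1 : ∀ {i j}, (i, j) ∈ T.filter (fun d => d.1 ∈ A ∧ d.2 ∈ A) ↔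
        (i, j) ∈ T ∧ i ∈ A ∧ j ∈ A := by simp
    refine ⟨fun hd => (mem1.1 hd).2.1, fun hd => (mem1.1 hd).2.2, fun hd => h.pos_le (mem1.1 hd).1,
      fun hd => h.val_le (mem1.1 hd).1,
      fun hi => mem1.2 ⟨h.leaf_mem (Finset.mem_filter.1 hi).1, hi, hi⟩, ?_⟩
    intro i j hd hnr
    obtain ⟨hij, hi, hj⟩ := mem1.1 hd
    have hiS := h.fst_mem hij
    have hjS := h.snd_mem hij
    have hjb : j ≠ b := by rintro rfl; exact hbL ((hmA hb).1 hj)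
    have key := h.parent hij (fun hr => hjb (hp (le_antisymm (hr.2 b hb) (hbmin j hjS))))
    refine Xor.of_iff key ?_ ?_
    · constructor
      · rintro ⟨k, hk, hk'⟩
        exact ⟨k, hk, (mem1.1 hk').1⟩
      · rintro ⟨k, hk, hik⟩
        by_cases hkr : (i, k) = (a, b)
        · obtain ⟨rfl, rfl⟩ := Prod.mk.inj hkr
          -- The parent lost here is the removed root. As `(a, j)` is not the root of the left part,
          -- some `x` in `A` has a smaller value, and its descent began at a dot of column `a` no
          -- lower than the row of `x`; that dot lies above `(a, j)`.
          have : ∃ x ∈ A, p x < p j := by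
            by_contra! hcon
            exact hnr ⟨fun x hx => hamin x (Finset.mem_filter.1 hx).1, hcon⟩
          obtain ⟨x, hx, hxj⟩ := this
          obtain ⟨l, h1, h2, h3⟩ := (facts (Finset.mem_filter.1 hx).2).2.2.2
          exact ⟨l, by omega, mem1.2 ⟨h1, hi, (hmA (h.snd_mem h1)).2 ((hright h1).1 (.base h1 h2))⟩⟩
        · exact ⟨k, hk, mem1.2 ⟨hik, hi, (hmA (h.snd_mem hik)).2
            ((hside hik hkr).1 ((hmA hiS).1 hi))⟩⟩
    · constructor
      · rintro ⟨k, hk, hk'⟩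
        exact ⟨k, hk, (mem1.1 hk').1⟩
      · rintro ⟨k, hk, hkj⟩
        exact ⟨k, hk, mem1.2 ⟨hkj, (hmA (h.fst_mem hkj)).2 ((hside hkj (fun hh =>
          hjb (Prod.mk.inj hh).2)).2 ((hmA hjS).1 hj)), hj⟩⟩
  · have mem2 : ∀ {i j}, (i, j) ∈ T.filter (fun d => d.1 ∈ S \ A ∧ d.2 ∈ S \ A) ↔
        (i, j) ∈ T ∧ i ∈ S \ A ∧ j ∈ S \ A := by simp
    have hmB : ∀ {x}, x ∈ S → (x ∈ S \ A ↔ ¬ LeftDot q p T a b x x) := fun hx => by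
      rw [Finset.mem_sdiff, hmA hx, and_iff_right hx]
    refine ⟨fun hd => (mem2.1 hd).2.1, fun hd => (mem2.1 hd).2.2, fun hd => h.pos_le (mem2.1 hd).1,
      fun hd => h.val_le (mem2.1 hd).1,
      fun hi => mem2.2 ⟨h.leaf_mem (Finset.mem_sdiff.1 hi).1, hi, hi⟩, ?_⟩
    intro i j hd hnr
    obtain ⟨hij, hi, hj⟩ := mem2.1 hd
    have hiS := h.fst_mem hij
    have hjS := h.snd_mem hij
    have hia : i ≠ a := by rintro rfl; exact (hmB ha).1 hi haL
    have key := h.parent hij (fun hr => hia (hq (le_antisymm (hr.1 a ha) (hamin i hiS))))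
    refine Xor.of_iff key ?_ ?_
    · constructor
      · rintro ⟨k, hk, hk'⟩
        exact ⟨k, hk, (mem2.1 hk').1⟩
      · rintro ⟨k, hk, hik⟩
        have hkr : (i, k) ≠ (a, b) := fun hh => hia (Prod.mk.inj hh).1
        exact ⟨k, hk, mem2.2 ⟨hik, hi, (hmB (h.snd_mem hik)).2
            ((hside hik hkr).not.1 ((hmB hiS).1 hi))⟩⟩
    · constructor
      · rintro ⟨k, hk, hk'⟩
        exact ⟨k, hk, (mem2.1 hk').1⟩
      · rintro ⟨k, hk, hkj⟩
        by_cases hkr : (k, j) = (a, b)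
        · obtain ⟨rfl, rfl⟩ := Prod.mk.inj hkr
          have : ∃ x ∈ S \ A, q x < q i := by
            by_contra! hcon
            exact hnr ⟨hcon, fun x hx => hbmin x (Finset.mem_sdiff.1 hx).1⟩
          obtain ⟨x, hx, hxi⟩ := this
          have hxS := (Finset.mem_sdiff.1 hx).1
          have hxl := (hmB hxS).1 hx
          obtain ⟨l, h1, h2, h3⟩ := hR _ x x le_rfl (h.leaf_mem hxS) (fun hh =>
            hab ((Prod.mk.inj hh).1.symm.trans (Prod.mk.inj hh).2)) hxl
          exact ⟨l, by omega, mem2.2 ⟨h1, (hmB (h.fst_mem h1)).2 ((hside h1 (fun hh =>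
            h2 (Prod.mk.inj hh).1)).not.2 hbL), hj⟩⟩
        · exact ⟨k, hk, mem2.2 ⟨hkj, (hmB (h.fst_mem hkj)).2 ((hside hkj hkr).not.2
            ((hmB hjS).1 hj)), hj⟩⟩
  · ext ⟨i, j⟩
    simp only [Finset.mem_insert, Finset.mem_union, Finset.mem_filter, Finset.mem_sdiff]
    constructor
    · intro hij
      by_cases hne : (i, j) = (a, b)
      · exact Or.inl hne
      · right
        have := hside hij hne
        rw [← hmA (h.fst_mem hij), ← hmA (h.snd_mem hij)] at this
        have h1 := h.fst_mem hij
        have h2 := h.snd_mem hij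
        tauto
    · rintro (hh | hh | hh)
      · rw [hh]; exact hroot
      · exact hh.1
      · exact hh.1

/-- Two trees are glued by adding a root dot. -/
theorem IsTreeOn.glue [DecidableEq V] (h1 : ∀ x ∈ S, q a ≤ q x)
    (h2 : ∀ x ∈ S, p b ≤ p x) (hq : q.Injective) (hp : p.Injective) {A : Finset V} (hA : A ⊆ S)
    (haA : a ∈ A) (hbS : b ∈ S) (hbA : b ∉ A) {T₁ T₂ : Finset (V × V)} (hT₁ : IsTreeOn q p A T₁)
    (hT₂ : IsTreeOn q p (S \ A) T₂) : IsTreeOn q p S (insert (a, b) (T₁ ∪ T₂)) := by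
  have hmem : ∀ {i j}, (i, j) ∈ insert (a, b) (T₁ ∪ T₂) ↔
      (i = a ∧ j = b) ∨ (i, j) ∈ T₁ ∨ (i, j) ∈ T₂ := by
    simp
  have haS := hA haA
  have hbB : b ∈ S \ A := Finset.mem_sdiff.2 ⟨hbS, hbA⟩
  have haB : a ∉ S \ A := fun hh => (Finset.mem_sdiff.1 hh).2 haA
  have hne : ∀ {i}, i ∈ S → i ≠ a → q a < q i := fun hi hia =>
    lt_of_le_of_ne (h1 _ hi) (hq.ne hia.symm)
  have hne' : ∀ {i}, i ∈ S → i ≠ b → p b < p i := fun hi hia =>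
    lt_of_le_of_ne (h2 _ hi) (hp.ne hia.symm)
  have hdisj : ∀ {x}, x ∈ A → x ∈ S \ A → False := fun hx hx' => (Finset.mem_sdiff.1 hx').2 hx
  refine ⟨?_, ?_, ?_, ?_, ?_, ?_⟩
  · intro i j hij
    rcases hmem.1 hij with ⟨rfl, rfl⟩ | hij | hij
    · exact haS
    · exact hA (hT₁.fst_mem hij)
    · exact (Finset.mem_sdiff.1 (hT₂.fst_mem hij)).1
  · intro i j hij
    rcases hmem.1 hij with ⟨rfl, rfl⟩ | hij | hij
    · exact hbS
    · exact hA (hT₁.snd_mem hij)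
    · exact (Finset.mem_sdiff.1 (hT₂.snd_mem hij)).1
  · intro i j hij
    rcases hmem.1 hij with ⟨rfl, rfl⟩ | hij | hij
    · exact h1 _ hbS
    · exact hT₁.pos_le hij
    · exact hT₂.pos_le hij
  · intro i j hij
    rcases hmem.1 hij with ⟨rfl, rfl⟩ | hij | hij
    · exact h2 _ haS
    · exact hT₁.val_le hij
    · exact hT₂.val_le hij
  · intro i hi
    by_cases hiA : i ∈ A
    · exact hmem.2 (Or.inr (Or.inl (hT₁.leaf_mem hiA)))
    · exact hmem.2 (Or.inr (Or.inr (hT₂.leaf_mem (Finset.mem_sdiff.2 ⟨hi, hiA⟩))))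
  · intro i j hij hnr
    rcases hmem.1 hij with ⟨rfl, rfl⟩ | hij | hij
    · exact absurd ⟨h1, h2⟩ hnr
    · have hi := hT₁.fst_mem hij
      have hj := hT₁.snd_mem hij
      have hjb : j ≠ b := fun hh => hbA (hh ▸ hj)
      have hl : (∃ k, q k < q i ∧ (k, j) ∈ insert (a, b) (T₁ ∪ T₂)) ↔
          ∃ k, q k < q i ∧ (k, j) ∈ T₁ := by
        refine exists_congr fun k => and_congr_right fun _ => ?_
        rw [hmem]
        exact ⟨fun hh => by
          rcases hh with hh | hh | hh
          · exact absurd hh.2 hjb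
          · exact hh
          · exact absurd (hT₂.snd_mem hh) (fun h' => hdisj hj h'), fun hh => Or.inr (Or.inl hh)⟩
      rw [hl]
      -- The root of `T₁` lies in column `a` and gains `(a, b)` as its parent. Any other dot of
      -- column `a` already has a dot above it in `T₁`, since nothing lies to its left, so the new
      -- root changes nothing there.
      by_cases hr : (∀ x ∈ A, q i ≤ q x) ∧ ∀ x ∈ A, p j ≤ p x
      · have hia : i = a := hq (le_antisymm (hr.1 a haA) (h1 i (hA hi)))
        subst hia
        refine Or.inl ⟨⟨b, hne' (hA hj) hjb, hmem.2 (Or.inl ⟨rfl, rfl⟩)⟩, ?_⟩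
        rintro ⟨k, hk, hk'⟩
        exact absurd (h1 k (hA (hT₁.fst_mem hk'))) (not_le.2 hk)
      · have hx := hT₁.parent hij hr
        refine Xor.of_iff hx ?_ Iff.rfl
        constructor
        · rintro ⟨k, hk, hk'⟩
          rcases hmem.1 hk' with ⟨rfl, rfl⟩ | hh | hh
          · rcases hx with hx | hx
            · exact hx.1
            · obtain ⟨⟨l, hl1, hl2⟩, -⟩ := hx
              exact absurd (h1 l (hA (hT₁.fst_mem hl2))) (not_le.2 hl1)
          · exact ⟨k, hk, hh⟩
          · exact (hdisj hi (hT₂.fst_mem hh)).elim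
        · rintro ⟨k, hk, hk'⟩
          exact ⟨k, hk, hmem.2 (Or.inr (Or.inl hk'))⟩
    · have hi := hT₂.fst_mem hij
      have hj := hT₂.snd_mem hij
      have hia : i ≠ a := fun hh => haB (hh ▸ hi)
      have hl : (∃ k, p k < p j ∧ (i, k) ∈ insert (a, b) (T₁ ∪ T₂)) ↔
          ∃ k, p k < p j ∧ (i, k) ∈ T₂ := by
        refine exists_congr fun k => and_congr_right fun _ => ?_
        rw [hmem]
        exact ⟨fun hh => by
          rcases hh with hh | hh | hh
          · exact absurd hh.1 hia
          · exact absurd (hT₁.fst_mem hh) (fun h' => hdisj h' hi)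
          · exact hh, fun hh => Or.inr (Or.inr hh)⟩
      rw [hl]
      by_cases hr : (∀ x ∈ S \ A, q i ≤ q x) ∧ ∀ x ∈ S \ A, p j ≤ p x
      · have hjb : j = b := hp (le_antisymm (hr.2 b hbB) (h2 j (Finset.mem_sdiff.1 hj).1))
        subst hjb
        refine Or.inr ⟨⟨a, hne (Finset.mem_sdiff.1 hi).1 hia, hmem.2 (Or.inl ⟨rfl, rfl⟩)⟩, ?_⟩
        rintro ⟨k, hk, hk'⟩
        exact absurd (h2 k (Finset.mem_sdiff.1 (hT₂.snd_mem hk')).1) (not_le.2 hk)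
      · have hx := hT₂.parent hij hr
        refine Xor.of_iff hx Iff.rfl ?_
        constructor
        · rintro ⟨k, hk, hk'⟩
          rcases hmem.1 hk' with ⟨rfl, rfl⟩ | hh | hh
          · rcases hx with hx | hx
            · obtain ⟨⟨l, hl1, hl2⟩, -⟩ := hx
              exact absurd (h2 l (Finset.mem_sdiff.1 (hT₂.snd_mem hl2)).1) (not_le.2 hl1)
            · exact hx.1
          · exact (hdisj (hT₁.snd_mem hh) hj).elim
          · exact ⟨k, hk, hh⟩
        · rintro ⟨k, hk, hk'⟩
          exact ⟨k, hk, hmem.2 (Or.inr (Or.inr hk'))⟩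

/-- The vertex set of the left subtree is determined by the tree. -/
theorem IsTreeOn.glue_subset [DecidableEq V] (hq : q.Injective) (hp : p.Injective)
    (h1 : ∀ x ∈ S, q a ≤ q x) {A A' : Finset V} (hA : A ⊆ S)
    (haA : a ∈ A) (hbA : b ∉ A) (haA' : a ∈ A') {T₁ T₂ T₁' T₂' : Finset (V × V)}
    (hT₁ : IsTreeOn q p A T₁) (hT₁' : IsTreeOn q p A' T₁') (hT₂' : IsTreeOn q p (S \ A') T₂')
    (heq : insert (a, b) (T₁ ∪ T₂) = insert (a, b) (T₁' ∪ T₂')) : A ⊆ A' := by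
  obtain ⟨c, hc, hcmin⟩ := A.exists_min_image p ⟨a, haA⟩
  -- Only the root dot joins `A'` to its complement, and it is not in `T₁` because `b ∉ A`.
  have := (hT₁.side_const hq hp (· ∈ A') (fun {i j} hij => by
    have : (i, j) ∈ insert (a, b) (T₁' ∪ T₂') := by rw [← heq]; simp [hij]
    simp only [Finset.mem_insert, Finset.mem_union, Prod.mk.injEq] at this
    rcases this with ⟨rfl, rfl⟩ | h | h
    · exact absurd (hT₁.snd_mem hij) hbA
    · exact iff_of_true (hT₁'.fst_mem h) (hT₁'.snd_mem h)
    · exact iff_of_false (Finset.mem_sdiff.1 (hT₂'.fst_mem h)).2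
        (Finset.mem_sdiff.1 (hT₂'.snd_mem h)).2) haA (fun x hx => h1 x (hA hx)) hcmin hc).1
  intro x hx
  exact (this x hx).2 haA'

/-- The recursion for the number of trees obtained by removing the root dot. -/
theorem treeCount_eq_sum [DecidableEq V] (hq : q.Injective) (hp : p.Injective)
    (ha : a ∈ S) (hamin : ∀ x ∈ S, q a ≤ q x) (hb : b ∈ S) (hbmin : ∀ x ∈ S, p b ≤ p x)
    (hab : a ≠ b) :
    treeCount q p S = ∑ A ∈ S.powerset with a ∈ A ∧ b ∉ A,
      treeCount q p A * treeCount q p (S \ A) := by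
  classical
  have hun : treesOn q p S = (S.powerset.filter (fun A => a ∈ A ∧ b ∉ A)).biUnion
      (fun A => (treesOn q p A ×ˢ treesOn q p (S \ A)).image
        (fun t => insert (a, b) (t.1 ∪ t.2))) := by
    ext T
    simp only [Finset.mem_biUnion, Finset.mem_filter, Finset.mem_powerset, Finset.mem_image,
      Finset.mem_product, mem_treesOn, Prod.exists]
    constructor
    · intro h
      obtain ⟨A, hA, haA, hbA, T₁, T₂, h1, h2, rfl⟩ := h.exists_split hq hp ha hamin hb hbmin hab
      exact ⟨A, ⟨hA, haA, hbA⟩, T₁, T₂, ⟨h1, h2⟩, rfl⟩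
    · rintro ⟨A, ⟨hA, haA, hbA⟩, T₁, T₂, ⟨h1, h2⟩, rfl⟩
      exact IsTreeOn.glue hamin hbmin hq hp hA haA hb hbA h1 h2
  rw [treeCount, hun, Finset.card_biUnion]
  · refine Finset.sum_congr rfl fun A hA => ?_
    simp only [Finset.mem_filter, Finset.mem_powerset] at hA
    rw [Finset.card_image_of_injOn, Finset.card_product, treeCount, treeCount]
    rintro ⟨T₁, T₂⟩ hT ⟨T₁', T₂'⟩ hT' heq
    simp only [Finset.coe_product, Set.mem_prod, Finset.mem_coe, mem_treesOn] at hT hT'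
    simp only at heq
    -- The subtrees are recovered as the dots with both coordinates in `A` or both outside; the root
    -- straddles the two sides.
    have hsep : ∀ {T₁ T₂ : Finset (V × V)}, IsTreeOn q p A T₁ → IsTreeOn q p (S \ A) T₂ →
        (insert (a, b) (T₁ ∪ T₂)).filter (fun d => d.1 ∈ A ∧ d.2 ∈ A) = T₁ ∧
        (insert (a, b) (T₁ ∪ T₂)).filter (fun d => d.1 ∉ A ∧ d.2 ∉ A) = T₂ := by
      intro T₁ T₂ h1 h2
      constructor
      · ext ⟨i, j⟩
        simp only [Finset.mem_filter, Finset.mem_insert, Finset.mem_union, Prod.mk.injEq]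
        constructor
        · rintro ⟨⟨rfl, rfl⟩ | h | h, h3, h4⟩
          · exact absurd h4 hA.2.2
          · exact h
          · exact absurd h3 (Finset.mem_sdiff.1 (h2.fst_mem h)).2
        · intro h
          exact ⟨Or.inr (Or.inl h), h1.fst_mem h, h1.snd_mem h⟩
      · ext ⟨i, j⟩
        simp only [Finset.mem_filter, Finset.mem_insert, Finset.mem_union, Prod.mk.injEq]
        constructor
        · rintro ⟨⟨rfl, rfl⟩ | h | h, h3, h4⟩
          · exact absurd hA.2.1 h3
          · exact absurd (h1.fst_mem h) h3
          · exact h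
        · intro h
          exact ⟨Or.inr (Or.inr h), (Finset.mem_sdiff.1 (h2.fst_mem h)).2,
            (Finset.mem_sdiff.1 (h2.snd_mem h)).2⟩
    have e1 := hsep hT.1 hT.2
    have e2 := hsep hT'.1 hT'.2
    rw [heq] at e1
    exact Prod.ext (e1.1.symm.trans e2.1) (e1.2.symm.trans e2.2)
  · intro A hA A' hA' hne
    simp only [Finset.coe_filter, Finset.mem_powerset, Set.mem_ofPred_eq] at hA hA'
    rw [Function.onFun, Finset.disjoint_left]
    rintro T hT hT'
    simp only [Finset.mem_image, Finset.mem_product, mem_treesOn, Prod.exists] at hT hT'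
    obtain ⟨T₁, T₂, ⟨h1, h2⟩, rfl⟩ := hT
    obtain ⟨T₁', T₂', ⟨h1', h2'⟩, heq⟩ := hT'
    exact hne (Finset.Subset.antisymm
      (IsTreeOn.glue_subset hq hp hamin hA.1 hA.2.1 hA.2.2 hA'.2.1 h1 h1' h2' heq.symm)
      (IsTreeOn.glue_subset hq hp hamin hA'.1 hA'.2.1 hA'.2.2 hA.2.1 h1' h1 h2 heq))

end

/-! ### Effect of a new vertex on the number of trees -/

section

variable {V : Type*} {q p : V → ℕ} {S : Finset V}

theorem cutConnected_singleton (x : V) : CutConnected q p {x} := by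
  intro X hX hne hne'
  rcases Finset.subset_singleton_iff.1 hX with h | h
  · exact absurd h hne.ne_empty
  · exact absurd h hne'

theorem CutConnected.insert_of_adj [DecidableEq V] (hS : CutConnected q p S) {u v : V} (hu : u ∈ S)
    (huv : InvAdj q p v u) : CutConnected q p (insert v S) := by
  intro X hX hne hne'
  by_cases h1 : X ∩ S = ∅
  · have hXv : ∀ x ∈ X, x = v := fun x hx => by
      rcases Finset.mem_insert.1 (hX hx) with h | h
      · exact h
      · exact absurd (Finset.mem_inter.2 ⟨hx, h⟩) (by simp [h1])
    obtain ⟨x, hx⟩ := hne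
    obtain rfl := hXv x hx
    refine ⟨x, hx, u, Finset.mem_insert_of_mem hu, fun hh => ?_, huv⟩
    exact huv.ne (hXv u hh).symm
  by_cases h2 : X ∩ S = S
  · have hSX : S ⊆ X := Finset.inter_eq_right.1 h2
    refine ⟨u, hSX hu, v, Finset.mem_insert_self v S, fun hv => ?_, huv.symm⟩
    exact hne' (Finset.Subset.antisymm hX (Finset.insert_subset hv hSX))
  · obtain ⟨x, hx, y, hy, hyX, hxy⟩ := hS (X ∩ S) Finset.inter_subset_right
      (Finset.nonempty_iff_ne_empty.2 h1) h2
    exact ⟨x, (Finset.mem_inter.1 hx).1, y, Finset.mem_insert_of_mem hy,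
      fun hh => hyX (Finset.mem_inter.2 ⟨hh, hy⟩), hxy⟩

theorem CutConnected.exists_adj (hS : CutConnected q p S) {v w : V} (hv : v ∈ S) (hw : w ∈ S)
    (hvw : w ≠ v) : ∃ y ∈ S, InvAdj q p v y := by
  obtain ⟨x, hx, y, hy, -, hxy⟩ := hS {v} (by simpa using hv) (Finset.singleton_nonempty v)
    (fun hh => hvw (by rw [← hh] at hw; exact Finset.mem_singleton.1 hw))
  rw [Finset.mem_singleton.1 hx] at hxy
  exact ⟨y, hy, hxy⟩

/-- A connected set can be built from any nonempty subset by adding vertices that have a neighbour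
among the vertices already there. -/
theorem CutConnected.induction_on [DecidableEq V] (hS : CutConnected q p S) {P : Finset V → Prop}
    {S₀ : Finset V} (h₀ : S₀ ⊆ S) (hne : S₀.Nonempty) (base : P S₀)
    (step : ∀ T, S₀ ⊆ T → T ⊆ S → P T → ∀ v ∈ S, v ∉ T → ∀ u ∈ T, InvAdj q p v u →
      P (insert v T)) : P S := by
  have key : ∀ N : ℕ, ∀ T, (S \ T).card = N → S₀ ⊆ T → T ⊆ S → P T → P S := by
    intro N
    induction N with
    | zero =>
      intro T hN _ hT hP
      have : S ⊆ T := Finset.sdiff_eq_empty_iff_subset.1 (Finset.card_eq_zero.1 hN)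
      rwa [Finset.Subset.antisymm this hT]
    | succ N ih =>
      intro T hN h0T hT hP
      have hTS : T ≠ S := by
        rintro rfl
        simp at hN
      obtain ⟨u, hu, v, hv, hvT, huv⟩ := hS T hT (hne.mono h0T) hTS
      refine ih (insert v T) ?_ (h0T.trans (Finset.subset_insert _ _))
        (Finset.insert_subset hv hT) (step T h0T hT hP v hv hvT u hu huv.symm)
      rw [Finset.sdiff_insert, Finset.card_erase_of_mem (Finset.mem_sdiff.2 ⟨hv, hvT⟩), hN]
      rfl
  exact key _ S₀ rfl (Finset.Subset.refl _) h₀ base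

/-- A connected set splits into two connected sets that separate two given vertices. -/
theorem CutConnected.exists_bipartition [DecidableEq V] (hS : CutConnected q p S) {b u : V}
    (hb : b ∈ S) (hu : u ∈ S) (hbu : b ≠ u) :
    ∃ B ⊆ S, b ∈ B ∧ u ∉ B ∧ CutConnected q p B ∧ CutConnected q p (S \ B) := by
  classical
  -- For a maximal such `B`, no vertex outside `B` other than `u` is adjacent to `B`. An edge
  -- leaving a part of the complement that misses `u` therefore ends in the complement.
  obtain ⟨B, hB, hmax⟩ := (S.powerset.filter
    (fun B => b ∈ B ∧ u ∉ B ∧ CutConnected q p B)).exists_max_image Finset.card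
    ⟨{b}, by simp [hb, hbu.symm, cutConnected_singleton]⟩
  simp only [Finset.mem_filter, Finset.mem_powerset] at hB hmax
  obtain ⟨hBS, hbB, huB, hBc⟩ := hB
  have hno : ∀ x ∈ S, x ∉ B → x ≠ u → ∀ y ∈ B, ¬ InvAdj q p x y := by
    intro x hx hxB hxu y hy hxy
    have := hmax (insert x B) ⟨Finset.insert_subset hx hBS, Finset.mem_insert_of_mem hbB,
      by simp [huB, hxu.symm], hBc.insert_of_adj hy hxy⟩
    rw [Finset.card_insert_of_notMem hxB] at this
    omega
  refine ⟨B, hBS, hbB, huB, hBc, ?_⟩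
  have main : ∀ X ⊆ S \ B, X.Nonempty → u ∉ X → ∃ x ∈ X, ∃ y ∈ S \ B, y ∉ X ∧ InvAdj q p x y := by
    intro X hX hne huX
    obtain ⟨x, hx, y, hy, hyX, hxy⟩ := hS X (hX.trans Finset.sdiff_subset) hne
      (fun hh => huX (hh ▸ hu))
    have hx' := Finset.mem_sdiff.1 (hX hx)
    refine ⟨x, hx, y, Finset.mem_sdiff.2 ⟨hy, fun hyB => ?_⟩, hyX, hxy⟩
    exact hno x hx'.1 hx'.2 (fun hh => huX (hh ▸ hx)) y hyB hxy
  intro X hX hne hne'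
  by_cases huX : u ∈ X
  · obtain ⟨x, hx, y, hy, hyX, hxy⟩ := main ((S \ B) \ X) Finset.sdiff_subset
      (Finset.sdiff_nonempty.2 fun hh => hne' (Finset.Subset.antisymm hX hh)) (by simp [huX])
    have hyX' : y ∈ X := by
      by_contra hh
      exact hyX (Finset.mem_sdiff.2 ⟨hy, hh⟩)
    exact ⟨y, hyX', x, (Finset.mem_sdiff.1 hx).1, (Finset.mem_sdiff.1 hx).2, hxy.symm⟩
  · exact main X hX hne huX

theorem invAdj_of_min (hq : q.Injective) (hp : p.Injective) {a b : V} (h1 : q a ≤ q b)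
    (h2 : p b ≤ p a) (hab : a ≠ b) : InvAdj q p a b :=
  Or.inl ⟨lt_of_le_of_ne h1 (hq.ne hab), lt_of_le_of_ne h2 (hp.ne hab.symm)⟩

/-- This handles `a = b` in the recursion: such a vertex is isolated, which contradicts
connectedness unless it is alone. -/
theorem not_invAdj_of_min {a : V} (h1 : ∀ x ∈ S, q a ≤ q x) (h2 : ∀ x ∈ S, p a ≤ p x) {x : V}
    (hx : x ∈ S) : ¬ InvAdj q p a x := by
  rintro (h | h)
  · exact absurd (h2 x hx) (not_le.2 h.2)
  · exact absurd (h1 x hx) (not_le.2 h.1)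

variable {a b v : V}

/-- The recursion for the number of trees, with one vertex apart that is neither the column nor the
row of the root. -/
theorem treeCount_insert [DecidableEq V] (hq : q.Injective) (hp : p.Injective) (hv : v ∉ S)
    (ha : a ∈ S) (hamin : ∀ x ∈ insert v S, q a ≤ q x) (hb : b ∈ S)
    (hbmin : ∀ x ∈ insert v S, p b ≤ p x) (hab : a ≠ b) :
    treeCount q p (insert v S) = ∑ A ∈ S.powerset with a ∈ A ∧ b ∉ A,
      (treeCount q p (insert v A) * treeCount q p (S \ A) +
        treeCount q p A * treeCount q p (insert v (S \ A))) := by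
  have hva : a ≠ v := fun hh => hv (hh ▸ ha)
  have hvb : b ≠ v := fun hh => hv (hh ▸ hb)
  rw [treeCount_eq_sum hq hp (Finset.mem_insert_of_mem ha) hamin (Finset.mem_insert_of_mem hb)
    hbmin hab, Finset.powerset_insert, Finset.filter_union, Finset.sum_union, add_comm,
    Finset.sum_add_distrib]
  · congr 1
    · rw [Finset.filter_image, Finset.sum_image]
      · simp only [Finset.mem_insert, hva, hvb, false_or]
        refine Finset.sum_congr rfl fun A hA => ?_
        congr 2
        ext x
        simp only [Finset.mem_sdiff, Finset.mem_insert]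
        have : x = v → x ∉ S := fun hh => hh ▸ hv
        tauto
      · intro A hA A' hA' hh
        simp only [Finset.coe_filter, Finset.mem_powerset, Set.mem_ofPred_eq] at hA hA'
        rw [← Finset.erase_insert (fun h' => hv (hA.1 h')), hh,
          Finset.erase_insert (fun h' => hv (hA'.1 h'))]
    · refine Finset.sum_congr rfl fun A hA => ?_
      simp only [Finset.mem_filter, Finset.mem_powerset] at hA
      rw [Finset.insert_sdiff_of_notMem _ (fun h' => hv (hA.1 h'))]
  · rw [Finset.disjoint_left]
    intro A hA hA'
    simp only [Finset.mem_filter, Finset.mem_powerset, Finset.mem_image] at hA hA'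
    obtain ⟨⟨A', -, rfl⟩, -⟩ := hA'
    exact hv (hA.1 (Finset.mem_insert_self _ _))

theorem exists_min_mem_insert [DecidableEq V] (f : V → ℕ) (v : V) (S : Finset V) :
    ∃ a ∈ insert v S, ∀ x ∈ insert v S, f a ≤ f x :=
  (insert v S).exists_min_image f (Finset.insert_nonempty v S)

theorem card_lt_card_of_notMem {A : Finset V} {x : V} (hA : A ⊆ S) (hx : x ∈ S) (hxA : x ∉ A) :
    A.card < S.card :=
  Finset.card_lt_card ⟨hA, fun hh => hxA (hh hx)⟩

theorem insert_sdiff_singleton_self [DecidableEq V] (hv : v ∉ S) : insert v S \ {v} = S := by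
  rw [Finset.sdiff_singleton_eq_erase, Finset.erase_insert hv]

theorem insert_sdiff_self [DecidableEq V] (hv : v ∉ S) : insert v S \ S = {v} := by
  rw [Finset.insert_sdiff_of_notMem _ hv, Finset.sdiff_self]; rfl

/-- Adding a vertex with exactly one neighbour does not change the number of trees. -/
theorem treeCount_insert_of_unique_adj [DecidableEq V] (hq : q.Injective) (hp : p.Injective)
    {u : V} (hv : v ∉ S) (hu : u ∈ S) (huv : InvAdj q p v u)
    (huniq : ∀ w ∈ S, InvAdj q p v w → w = u) : treeCount q p (insert v S) = treeCount q p S := by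
  induction hN : S.card using Nat.strong_induction_on generalizing S with
  | _ N ih =>
  obtain ⟨a, ha, hamin⟩ := exists_min_mem_insert q v S
  obtain ⟨b, hb, hbmin⟩ := exists_min_mem_insert p v S
  have huS : u ∈ insert v S := Finset.mem_insert_of_mem hu
  by_cases hab : a = b
  · subst hab
    have hiso := fun x hx => not_invAdj_of_min (x := x) hamin hbmin hx
    have hav : a ≠ v := by rintro rfl; exact hiso u huS huv
    have hau : u ≠ a := by rintro rfl; exact hiso v (Finset.mem_insert_self _ _) huv.symm
    have haS := Finset.mem_of_mem_insert_of_ne ha hav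
    rw [treeCount_eq_zero hq hp, treeCount_eq_zero hq hp]
    · intro hc
      obtain ⟨y, hy, hay⟩ := hc.exists_adj haS hu hau
      exact hiso y (Finset.mem_insert_of_mem hy) hay
    · intro hc
      obtain ⟨y, hy, hay⟩ := hc.exists_adj ha huS hau
      exact hiso y hy hay
  have hadj : InvAdj q p a b := invAdj_of_min hq hp (hamin b hb) (hbmin a ha) hab
  -- The root is an edge, so the only neighbour of `v` is `b`. In any `A` without `b` the vertex `v`
  -- is isolated, and only the split `{a}` survives. The case `b = v` is symmetric.
  by_cases hav : a = v
  · subst hav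
    have hbS := Finset.mem_of_mem_insert_of_ne hb (Ne.symm hab)
    have hbu : b = u := huniq b hbS hadj
    subst hbu
    rw [treeCount_eq_sum hq hp ha hamin hb hbmin hab, Finset.sum_eq_single {a}]
    · rw [treeCount_singleton, one_mul, insert_sdiff_singleton_self hv]
    · intro A hA hne
      simp only [Finset.mem_filter, Finset.mem_powerset] at hA
      rw [treeCount_eq_zero hq hp, zero_mul]
      intro hc
      obtain ⟨w, hw, hwa⟩ : ∃ w ∈ A, w ≠ a := by
        by_contra! hcon
        exact hne (Finset.eq_singleton_iff_unique_mem.2 ⟨hA.2.1, hcon⟩)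
      obtain ⟨y, hy, hay⟩ := hc.exists_adj hA.2.1 hw hwa
      exact hA.2.2 (huniq y (Finset.mem_of_mem_insert_of_ne (hA.1 hy) hay.symm.ne) hay ▸ hy)
    · intro hh
      exact absurd (by simp [Ne.symm hab]) hh
  by_cases hbv : b = v
  · subst hbv
    have haS := Finset.mem_of_mem_insert_of_ne ha hab
    have hau : a = u := huniq a haS hadj.symm
    subst hau
    rw [treeCount_eq_sum hq hp ha hamin hb hbmin hab, Finset.sum_eq_single S]
    · rw [insert_sdiff_self hv, treeCount_singleton, mul_one]
    · intro A hA hne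
      simp only [Finset.mem_filter, Finset.mem_powerset] at hA
      rw [treeCount_eq_zero hq hp (S := insert b S \ A), mul_zero]
      intro hc
      have hAS : A ⊆ S := fun x hx =>
        Finset.mem_of_mem_insert_of_ne (hA.1 hx) (fun hh => hA.2.2 (hh ▸ hx))
      obtain ⟨w, hw, hwA⟩ := Finset.exists_of_ssubset (Finset.ssubset_iff_subset_ne.2 ⟨hAS, hne⟩)
      obtain ⟨y, hy, hby⟩ := hc.exists_adj (Finset.mem_sdiff.2 ⟨hb, hA.2.2⟩)
        (Finset.mem_sdiff.2 ⟨Finset.mem_insert_of_mem hw, hwA⟩) (fun hh => hv (hh ▸ hw))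
      have hy' := Finset.mem_sdiff.1 hy
      exact hy'.2 (huniq y (Finset.mem_of_mem_insert_of_ne hy'.1 hby.symm.ne) hby ▸ hA.2.1)
    · intro hh
      exact absurd (by simp [haS, hv]) hh
  have haS := Finset.mem_of_mem_insert_of_ne ha hav
  have hbS := Finset.mem_of_mem_insert_of_ne hb hbv
  rw [treeCount_insert hq hp hv haS hamin hbS hbmin hab, treeCount_eq_sum hq hp haS
    (fun x hx => hamin x (Finset.mem_insert_of_mem hx)) hbS
    (fun x hx => hbmin x (Finset.mem_insert_of_mem hx)) hab]
  -- On the side without `u` the vertex `v` would be isolated, so in each split it must join the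
  -- side of `u`, where induction applies.
  have hzero : ∀ B ⊆ S, u ∉ B → B.Nonempty → treeCount q p (insert v B) = 0 := by
    rintro B hB huB ⟨w, hw⟩
    refine treeCount_eq_zero hq hp fun hc => ?_
    obtain ⟨y, hy, hvy⟩ := hc.exists_adj (Finset.mem_insert_self v B)
      (Finset.mem_insert_of_mem hw) (fun hh => hv (hB (hh ▸ hw)))
    have hyB := Finset.mem_of_mem_insert_of_ne hy hvy.symm.ne
    exact huB (huniq y (hB hyB) hvy ▸ hyB)
  refine Finset.sum_congr rfl fun A hA => ?_
  simp only [Finset.mem_filter, Finset.mem_powerset] at hA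
  obtain ⟨hAS, haA, hbA⟩ := hA
  by_cases huA : u ∈ A
  · rw [ih A.card (hN ▸ card_lt_card_of_notMem hAS hbS hbA) (fun hh => hv (hAS hh))
      huA (fun w hw => huniq w (hAS hw)) rfl,
      hzero (S \ A) Finset.sdiff_subset (by simp [huA]) ⟨b, by simp [hbS, hbA]⟩, mul_zero, add_zero]
  · rw [ih (S \ A).card (hN ▸ card_lt_card_of_notMem Finset.sdiff_subset haS
      (fun hh => (Finset.mem_sdiff.1 hh).2 haA))
      (fun hh => hv (Finset.mem_sdiff.1 hh).1)
      (Finset.mem_sdiff.2 ⟨hu, huA⟩) (fun w hw => huniq w (Finset.mem_sdiff.1 hw).1) rfl,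
      hzero A hAS huA ⟨a, haA⟩, zero_mul, zero_add]

/-- Adding a vertex with a neighbour does not decrease the number of trees. -/
theorem treeCount_le_insert [DecidableEq V] (hq : q.Injective) (hp : p.Injective)
    {u : V} (hv : v ∉ S) (hu : u ∈ S) (huv : InvAdj q p v u) :
    treeCount q p S ≤ treeCount q p (insert v S) := by
  induction hN : S.card using Nat.strong_induction_on generalizing S u with
  | _ N ih =>
  by_cases hS : CutConnected q p S
  swap
  · rw [treeCount_eq_zero hq hp hS]; exact Nat.zero_le _
  obtain ⟨a, ha, hamin⟩ := exists_min_mem_insert q v S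
  obtain ⟨b, hb, hbmin⟩ := exists_min_mem_insert p v S
  have huS : u ∈ insert v S := Finset.mem_insert_of_mem hu
  have hab : a ≠ b := by
    rintro rfl
    have hiso := fun x hx => not_invAdj_of_min (x := x) hamin hbmin hx
    have hau : u ≠ a := by rintro rfl; exact hiso v (Finset.mem_insert_self _ _) huv.symm
    obtain ⟨y, hy, hay⟩ := (hS.insert_of_adj hu huv).exists_adj ha huS hau
    exact hiso y hy hay
  by_cases hav : a = v
  · subst hav
    rw [treeCount_eq_sum hq hp ha hamin hb hbmin hab]
    refine le_trans ?_ (Finset.single_le_sum (fun _ _ => Nat.zero_le _) (a := {a})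
      (by simp [Ne.symm hab]))
    rw [treeCount_singleton, one_mul, insert_sdiff_singleton_self hv]
  by_cases hbv : b = v
  · subst hbv
    have haS := Finset.mem_of_mem_insert_of_ne ha hab
    rw [treeCount_eq_sum hq hp ha hamin hb hbmin hab]
    refine le_trans ?_ (Finset.single_le_sum (fun _ _ => Nat.zero_le _) (a := S)
      (by simp [haS, hv]))
    rw [insert_sdiff_self hv, treeCount_singleton, mul_one]
  have haS := Finset.mem_of_mem_insert_of_ne ha hav
  have hbS := Finset.mem_of_mem_insert_of_ne hb hbv
  rw [treeCount_insert hq hp hv haS hamin hbS hbmin hab, treeCount_eq_sum hq hp haS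
    (fun x hx => hamin x (Finset.mem_insert_of_mem hx)) hbS
    (fun x hx => hbmin x (Finset.mem_insert_of_mem hx)) hab]
  refine Finset.sum_le_sum fun A hA => ?_
  simp only [Finset.mem_filter, Finset.mem_powerset] at hA
  obtain ⟨hAS, haA, hbA⟩ := hA
  by_cases huA : u ∈ A
  · exact le_add_right (Nat.mul_le_mul_right _ (ih A.card (hN ▸ card_lt_card_of_notMem hAS hbS hbA) (fun hh => hv (hAS hh))
      huA huv rfl))
  · exact le_add_left (Nat.mul_le_mul_left _ (ih (S \ A).card (hN ▸ card_lt_card_of_notMem Finset.sdiff_subset haS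
      (fun hh => (Finset.mem_sdiff.1 hh).2 haA))
      (fun hh => hv (Finset.mem_sdiff.1 hh).1)
      (Finset.mem_sdiff.2 ⟨hu, huA⟩) huv rfl))

/-- This carries a lower bound from a small pattern to the whole vertex set. The subset `T` need not
be connected. -/
theorem treeCount_mono [DecidableEq V] (hq : q.Injective) (hp : p.Injective)
    (hS : CutConnected q p S) {T : Finset V} (hT : T ⊆ S) (hne : T.Nonempty) :
    treeCount q p T ≤ treeCount q p S :=
  hS.induction_on (P := fun T' => treeCount q p T ≤ treeCount q p T') hT hne le_rfl
    fun _ _ _ h _ _ hv _ hu huv => h.trans (treeCount_le_insert hq hp hv hu huv)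

theorem treeCount_pos (hq : q.Injective) (hp : p.Injective)
    (hS : CutConnected q p S) : 0 < treeCount q p S := by
  classical
  rcases S.eq_empty_or_nonempty with rfl | ⟨x, hx⟩
  · rw [treeCount_empty]; exact Nat.one_pos
  · have := treeCount_mono hq hp hS (Finset.singleton_subset_iff.2 hx) (Finset.singleton_nonempty x)
    rw [treeCount_singleton] at this
    exact this

/-- Adding a vertex with at least two neighbours to a connected set increases the number of
trees. -/
theorem treeCount_lt_insert [DecidableEq V] (hq : q.Injective) (hp : p.Injective)
    (hS : CutConnected q p S)
    {u w : V} (hv : v ∉ S) (hu : u ∈ S) (huv : InvAdj q p v u) (hw : w ∈ S) (hwv : InvAdj q p v w)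
    (huw : u ≠ w) : treeCount q p S < treeCount q p (insert v S) := by
  induction hN : S.card using Nat.strong_induction_on generalizing S with
  | _ N ih =>
  obtain ⟨a, ha, hamin⟩ := exists_min_mem_insert q v S
  obtain ⟨b, hb, hbmin⟩ := exists_min_mem_insert p v S
  have huS : u ∈ insert v S := Finset.mem_insert_of_mem hu
  have hab : a ≠ b := by
    rintro rfl
    have hiso := fun x hx => not_invAdj_of_min (x := x) hamin hbmin hx
    have hau : u ≠ a := by rintro rfl; exact hiso v (Finset.mem_insert_self _ _) huv.symm
    obtain ⟨y, hy, hay⟩ := (hS.insert_of_adj hu huv).exists_adj ha huS hau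
    exact hiso y hy hay
  have hother : ∀ c, ∃ x ∈ S, InvAdj q p v x ∧ c ≠ x := by
    intro c
    by_cases hc : c = u
    · exact ⟨w, hw, hwv, hc ▸ huw⟩
    · exact ⟨u, hu, huv, hc⟩
  by_cases hav : a = v
  · subst hav
    have hbS := Finset.mem_of_mem_insert_of_ne hb (Ne.symm hab)
    obtain ⟨x, hxS, hax, hbx⟩ := hother b
    -- The split `{a}` alone contributes the count of `S`. Putting `a` with the connected part that
    -- contains another neighbour `x`, opposite to `b`, gives a second nonzero term.
    obtain ⟨B, hBS, hbB, hxB, hB, hB'⟩ := hS.exists_bipartition hbS hxS hbx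
    have hxB' : x ∈ S \ B := Finset.mem_sdiff.2 ⟨hxS, hxB⟩
    have hne : ({a} : Finset V) ≠ insert a (S \ B) := fun hh => by
      have : x ∈ insert a (S \ B) := Finset.mem_insert_of_mem hxB'
      rw [← hh, Finset.mem_singleton] at this
      exact hax.ne this.symm
    have hcompl : insert a S \ insert a (S \ B) = B := by
      ext y
      have h1 : y = a → y ∉ S := fun hh => hh ▸ hv
      have h2 := @hBS y
      simp only [Finset.mem_sdiff, Finset.mem_insert]
      tauto
    rw [treeCount_eq_sum hq hp ha hamin hb hbmin hab]
    refine lt_of_lt_of_le ?_ (Finset.sum_le_sum_of_subset (s := {{a}, insert a (S \ B)}) ?_)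
    · rw [Finset.sum_pair hne, treeCount_singleton, one_mul, insert_sdiff_singleton_self hv, hcompl]
      have := Nat.mul_pos (treeCount_pos hq hp (hB'.insert_of_adj hxB' hax)) (treeCount_pos hq hp hB)
      omega
    · intro A hA
      rcases Finset.mem_insert.1 hA with rfl | hA
      · simp [Ne.symm hab]
      · rw [Finset.mem_singleton.1 hA]
        simp [hbB, Ne.symm hab, Finset.insert_subset_insert]
  by_cases hbv : b = v
  · subst hbv
    have haS := Finset.mem_of_mem_insert_of_ne ha hab
    obtain ⟨x, hxS, hbx, hax⟩ := hother a
    obtain ⟨A, hAS, haA, hxA, hA, hA'⟩ := hS.exists_bipartition haS hxS hax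
    have hxA' : x ∈ S \ A := Finset.mem_sdiff.2 ⟨hxS, hxA⟩
    have hbA : b ∉ A := fun hh => hv (hAS hh)
    have hne : S ≠ A := fun hh => hxA (hh ▸ hxS)
    rw [treeCount_eq_sum hq hp ha hamin hb hbmin hab]
    refine lt_of_lt_of_le ?_ (Finset.sum_le_sum_of_subset (s := {S, A}) ?_)
    · rw [Finset.sum_pair hne, insert_sdiff_self hv, treeCount_singleton, mul_one,
        Finset.insert_sdiff_of_notMem _ hbA]
      have := Nat.mul_pos (treeCount_pos hq hp hA) (treeCount_pos hq hp (hA'.insert_of_adj hxA' hbx))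
      omega
    · intro A' hA'
      rcases Finset.mem_insert.1 hA' with rfl | hA'
      · simp [haS, hv]
      · rw [Finset.mem_singleton.1 hA']
        simp [haA, hbA, hAS.trans (Finset.subset_insert b S)]
  have haS := Finset.mem_of_mem_insert_of_ne ha hav
  have hbS := Finset.mem_of_mem_insert_of_ne hb hbv
  have hpos := treeCount_pos hq hp hS
  have hsum := treeCount_eq_sum hq hp haS
    (fun x hx => hamin x (Finset.mem_insert_of_mem hx)) hbS
    (fun x hx => hbmin x (Finset.mem_insert_of_mem hx)) hab
  -- Each nonzero term grows: if both neighbours are on one side, by induction for that side; if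
  -- they are separated, because `v` may join either side, which at least doubles the term.
  have hlt : ∀ A, A ∈ S.powerset.filter (fun A => a ∈ A ∧ b ∉ A) →
      0 < treeCount q p A * treeCount q p (S \ A) →
      treeCount q p A * treeCount q p (S \ A) <
        treeCount q p (insert v A) * treeCount q p (S \ A) +
        treeCount q p A * treeCount q p (insert v (S \ A)) := by
    intro A hA h0
    simp only [Finset.mem_filter, Finset.mem_powerset] at hA
    obtain ⟨hAS, haA, hbA⟩ := hA
    have hA0 := Nat.pos_of_mul_pos_right h0
    have hB0 := Nat.pos_of_mul_pos_left h0
    have hcA := cutConnected_of_treeCount_pos hq hp hA0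
    have hcB := cutConnected_of_treeCount_pos hq hp hB0
    have hvA : v ∉ A := fun hh => hv (hAS hh)
    have hvB : v ∉ S \ A := fun hh => hv (Finset.mem_sdiff.1 hh).1
    have lowA : ∀ x ∈ A, InvAdj q p v x → treeCount q p A ≤ treeCount q p (insert v A) :=
      fun x hx hvx => treeCount_le_insert hq hp hvA hx hvx
    have lowB : ∀ x ∈ S, x ∉ A → InvAdj q p v x →
        treeCount q p (S \ A) ≤ treeCount q p (insert v (S \ A)) :=
      fun x hx hxA hvx => treeCount_le_insert hq hp hvB (Finset.mem_sdiff.2 ⟨hx, hxA⟩) hvx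
    have both : treeCount q p A ≤ treeCount q p (insert v A) →
        treeCount q p (S \ A) ≤ treeCount q p (insert v (S \ A)) →
        treeCount q p A * treeCount q p (S \ A) <
          treeCount q p (insert v A) * treeCount q p (S \ A) +
          treeCount q p A * treeCount q p (insert v (S \ A)) := fun h1 h2 => by
      have h3 := Nat.mul_le_mul_right (treeCount q p (S \ A)) h1
      have h4 := Nat.mul_le_mul_left (treeCount q p A) h2
      omega
    by_cases huA : u ∈ A <;> by_cases hwA : w ∈ A
    · have h1 := ih A.card (hN ▸ card_lt_card_of_notMem hAS hbS hbA) hcA hvA huA hwA rfl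
      have := Nat.mul_lt_mul_of_pos_right h1 hB0
      omega
    · exact both (lowA u huA huv) (lowB w hw hwA hwv)
    · exact both (lowA w hwA hwv) (lowB u hu huA huv)
    · have h1 := ih (S \ A).card (hN ▸ card_lt_card_of_notMem Finset.sdiff_subset haS
      (fun hh => (Finset.mem_sdiff.1 hh).2 haA)) hcB hvB
        (Finset.mem_sdiff.2 ⟨hu, huA⟩) (Finset.mem_sdiff.2 ⟨hw, hwA⟩) rfl
      have := Nat.mul_lt_mul_of_pos_left h1 hA0
      omega
  rw [treeCount_insert hq hp hv haS hamin hbS hbmin hab, hsum]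
  refine Finset.sum_lt_sum (fun A hA => ?_) ?_
  · rcases Nat.eq_zero_or_pos (treeCount q p A * treeCount q p (S \ A)) with h0 | h0
    · rw [h0]; exact Nat.zero_le _
    · exact (hlt A hA h0).le
  · rw [hsum] at hpos
    obtain ⟨A, hA, h0⟩ := Finset.exists_ne_zero_of_sum_ne_zero hpos.ne'
    exact ⟨A, hA, hlt A hA (Nat.pos_of_ne_zero h0)⟩

end

/-! ### Tree counts of the patterns 321 and 3412 -/

section

variable {V : Type*} {q p : V → ℕ} {S : Finset V}

theorem treeCount_pair [DecidableEq V] (hq : q.Injective) (hp : p.Injective) {x y : V}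
    (h : InvAdj q p x y) : treeCount q p {x, y} = 1 := by
  rw [treeCount_insert_of_unique_adj hq hp (u := y) (by simpa using h.ne) (by simp) h (by simp),
    treeCount_singleton]

/-- The decreasing pattern on three vertices has two trees. -/
theorem treeCount_triangle [DecidableEq V] (hq : q.Injective) (hp : p.Injective) {i j k : V}
    (hij : q i < q j) (hjk : q j < q k) (hkj : p k < p j) (hji : p j < p i) :
    treeCount q p {j, i, k} = 2 := by
  have h1 : InvAdj q p j i := Or.inr ⟨hij, hji⟩
  have h2 : InvAdj q p j k := Or.inl ⟨hjk, hkj⟩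
  have hik : i ≠ k := by rintro rfl; omega
  -- The only split of `{i, k}` is `{i}` against `{k}`, and `j` may join either side.
  rw [treeCount_insert hq hp (v := j) (a := i) (b := k) (by simp [h1.ne, h2.ne]) (by simp)
    (by simp; omega) (by simp) (by simp; omega) hik, Finset.sum_eq_single {i}]
  · have : ({i, k} : Finset V) \ {i} = {k} := by
      rw [insert_sdiff_singleton_self (by simpa using hik)]
    rw [this, treeCount_singleton, treeCount_singleton, treeCount_pair hq hp h1,
      treeCount_pair hq hp h2]
  · intro A hA hne
    simp only [Finset.mem_filter, Finset.mem_powerset] at hA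
    refine absurd (Finset.eq_singleton_iff_unique_mem.2 ⟨hA.2.1, fun x hx => ?_⟩) hne
    rcases Finset.mem_insert.1 (hA.1 hx) with h | h
    · exact h
    · exact absurd (Finset.mem_singleton.1 h ▸ hx) hA.2.2
  · intro hh
    exact absurd (by simp [hik.symm]) hh

/-- The pattern `3412`. -/
def Is3412 {V : Type*} (q p : V → ℕ) (x y z w : V) : Prop :=
  (q x < q y ∧ q y < q z ∧ q z < q w) ∧ p z < p w ∧ p w < p x ∧ p x < p y

theorem three_le_treeCount_of_is3412 [DecidableEq V] (hq : q.Injective) (hp : p.Injective)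
    {x y z w : V} (h : Is3412 q p x y z w) : 3 ≤ treeCount q p {y, x, z, w} := by
  obtain ⟨⟨hxy, hyz, hzw⟩, h1, h2, h3⟩ := h
  have hxz : x ≠ z := by rintro rfl; omega
  have hxw : x ≠ w := by rintro rfl; omega
  have hzw' : z ≠ w := by rintro rfl; omega
  have hyx' : y ≠ x := by rintro rfl; omega
  have axw : InvAdj q p x w := Or.inl ⟨by omega, by omega⟩
  have ayz : InvAdj q p y z := Or.inl ⟨by omega, by omega⟩
  have ayw : InvAdj q p y w := Or.inl ⟨by omega, by omega⟩
  have azx : InvAdj q p z x := Or.inr ⟨by omega, by omega⟩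
  rw [treeCount_insert hq hp (v := y) (a := x) (b := z) (by simp [hyx', ayz.ne, ayw.ne]) (by simp)
    (by simp; omega) (by simp) (by simp; omega) hxz]
  have hne : ({x} : Finset V) ≠ {x, w} := fun hh => by
    have : w ∈ ({x} : Finset V) := by rw [hh]; simp
    exact hxw (Finset.mem_singleton.1 this).symm
  -- With `{x}` against `{z, w}`, the vertex `y` can join `z` and `w`: at least one tree. With `{x,
  -- w}` against `{z}`, it can join either side: at least two more.
  refine le_trans ?_ (Finset.sum_le_sum_of_subset (s := {{x}, {x, w}}) ?_)
  · have e1 : ({x, z, w} : Finset V) \ {x} = {z, w} :=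
      insert_sdiff_singleton_self (by simp [hxz, hxw])
    have e2 : ({x, z, w} : Finset V) \ {x, w} = {z} := by
      rw [Finset.insert_comm, insert_sdiff_self (by simp [hxz.symm, hzw'])]
    have c1 : CutConnected q p {y, z, w} := by
      rw [Finset.insert_comm]
      exact ((cutConnected_singleton w).insert_of_adj (by simp) ayw).insert_of_adj
        (u := y) (by simp) ayz.symm
    have c2 : CutConnected q p {y, x, w} :=
      ((cutConnected_singleton w).insert_of_adj (by simp) axw).insert_of_adj
        (u := w) (by simp) ayw
    have p1 := treeCount_pos hq hp c1
    have p2 := treeCount_pos hq hp c2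
    rw [Finset.sum_pair hne, e1, e2, treeCount_singleton, treeCount_singleton,
      treeCount_pair hq hp axw, treeCount_pair hq hp ayz]
    omega
  · intro A hA
    rcases Finset.mem_insert.1 hA with rfl | hA
    · simp [hxz.symm]
    · rw [Finset.mem_singleton.1 hA]
      simp [hxz.symm, hzw', Finset.insert_subset_insert]

/-- Cut `S` just after the position of `u`. A crossing edge from `t` to `b` is forced, by the
absence of triangles at `v`, to have `t` adjacent to `u` and not to `v`. Then `v` and `t`, in order
of position, followed by `u` and either `b` or `w`, form 3412; the last letter is `b` if its value
is below that of `v`. -/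
theorem false_of_two_right_adj (hq : q.Injective) (hp : p.Injective) (hS : CutConnected q p S)
    {u v w : V} (hv : v ∉ S) (hu : u ∈ S) (hw : w ∈ S)
    (htri : ∀ x y, InvAdj q p v x → InvAdj q p v y → ¬ InvAdj q p x y)
    (h3412 : ∀ x y z w, ¬ Is3412 q p x y z w)
    (hvu : q v < q u) (huv : p u < p v) (hwv : p w < p v) (huw : q u < q w) : False := by
  obtain ⟨t, ht, b, hb, hbX, htb⟩ := hS (S.filter (fun x => q x ≤ q u)) (Finset.filter_subset _ _)
    ⟨u, by simp [hu]⟩ (fun hh => by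
      have := hh ▸ hw
      simp only [Finset.mem_filter] at this
      omega)
  simp only [Finset.mem_filter, not_and, not_le] at ht hbX
  have hub := hbX hb
  have htv : t ≠ v := fun hh => hv (hh ▸ ht.1)
  have au : InvAdj q p v u := Or.inl ⟨hvu, huv⟩
  have aw : InvAdj q p v w := Or.inl ⟨by omega, hwv⟩
  have hbt : p b < p t := by rcases htb with h | h <;> omega
  have pne : ∀ {x y}, q x < q y → p x ≠ p y := fun h => hp.ne (fun hh => by rw [hh] at h; omega)
  have hpuw : p u < p w := by
    by_contra hh
    exact htri u w au aw (Or.inl ⟨huw, lt_of_le_of_ne (not_lt.1 hh) (pne huw).symm⟩)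
  have hpub : p u < p b := by
    by_contra hh
    have : p b < p u := lt_of_le_of_ne (not_lt.1 hh) (pne hub).symm
    exact htri u b au (Or.inl ⟨by omega, by omega⟩) (Or.inl ⟨hub, this⟩)
  have hqtu : q t < q u := lt_of_le_of_ne ht.2 (hq.ne (by rintro rfl; omega))
  have atu : InvAdj q p u t := Or.inr ⟨hqtu, by omega⟩
  have key : (q v < q t ∧ p v < p t) ∨ (q t < q v ∧ p t < p v) := by
    have h1 := htri u t au
    have h2 := hq.ne htv
    have h3 := hp.ne htv
    by_contra hcon
    exact h1 (by unfold InvAdj; omega) atu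
  by_cases hbv : p b < p v
  · rcases key with h | h
    · exact h3412 v t u b ⟨⟨h.1, hqtu, hub⟩, hpub, hbv, h.2⟩
    · exact h3412 t v u b ⟨⟨h.1, hvu, hub⟩, hpub, hbt, h.2⟩
  · rcases key with h | h
    · exact h3412 v t u w ⟨⟨h.1, hqtu, huw⟩, hpuw, hwv, h.2⟩
    · exact h3412 t v u w ⟨⟨h.1, hvu, huw⟩, hpuw, by omega, h.2⟩

theorem CutConnected.swap (hS : CutConnected q p S) : CutConnected p q S := by
  intro X hX hne hne'
  obtain ⟨x, hx, y, hy, hyX, h⟩ := hS X hX hne hne'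
  exact ⟨x, hx, y, hy, hyX, h.swap⟩

/-- A vertex in no triangle has at most one neighbour in a connected set, if there is no pattern
`3412`. -/
theorem eq_of_adj_of_adj (hq : q.Injective) (hp : p.Injective) (hS : CutConnected q p S)
    {u v w : V} (hv : v ∉ S) (hu : u ∈ S) (hw : w ∈ S)
    (htri : ∀ x y, InvAdj q p v x → InvAdj q p v y → ¬ InvAdj q p x y)
    (h3412 : ∀ x y z w, ¬ Is3412 q p x y z w)
    (huv : InvAdj q p v u) (hwv : InvAdj q p v w) : u = w := by
  -- Exchanging `q` and `p` is passage to the inverse permutation. It preserves 3412 and turns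
  -- neighbours on the left into neighbours on the right. Neighbours on opposite sides of `v` would
  -- form a triangle with it.
  have htri' : ∀ x y, InvAdj p q v x → InvAdj p q v y → ¬ InvAdj p q x y :=
    fun x y h1 h2 h3 => htri x y h1.swap h2.swap h3.swap
  have h3412' : ∀ x y z w, ¬ Is3412 p q x y z w :=
    fun x y z w h => h3412 z w x y ⟨h.2, h.1⟩
  have hnot := htri u w huv hwv
  by_contra hne
  have hqne := hq.ne hne
  have hpne := hp.ne hne
  rcases huv with h1 | h1 <;> rcases hwv with h2 | h2
  · rcases lt_or_gt_of_ne hqne with h | h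
    · exact false_of_two_right_adj hq hp hS hv hu hw htri h3412 h1.1 h1.2 h2.2 h
    · exact false_of_two_right_adj hq hp hS hv hw hu htri h3412 h2.1 h2.2 h1.2 h
  · exact hnot (Or.inr ⟨by omega, by omega⟩)
  · exact hnot (Or.inl ⟨by omega, by omega⟩)
  · rcases lt_or_gt_of_ne hpne with h | h
    · exact false_of_two_right_adj hp hq hS.swap hv hu hw htri' h3412' h1.2 h1.1 h2.1 h
    · exact false_of_two_right_adj hp hq hS.swap hv hw hu htri' h3412' h2.2 h2.1 h1.1 h

/-- The pattern `321`. -/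
def Is321 {V : Type*} (q p : V → ℕ) (x y z : V) : Prop :=
  (q x < q y ∧ q y < q z) ∧ p z < p y ∧ p y < p x

/-- Of the eight orientations of the three edges, the two cyclic ones are impossible and each of the
others orders the vertices into a 321. -/
theorem exists_is321_of_triangle {v x y : V} (h1 : InvAdj q p v x) (h2 : InvAdj q p v y)
    (h3 : InvAdj q p x y) : ∃ i j k, Is321 q p i j k ∧ (v = i ∨ v = j ∨ v = k) := by
  rcases h1 with h1 | h1 <;> rcases h2 with h2 | h2 <;> rcases h3 with h3 | h3
  · exact ⟨v, x, y, ⟨⟨h1.1, h3.1⟩, h3.2, h1.2⟩, by simp⟩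
  · exact ⟨v, y, x, ⟨⟨h2.1, h3.1⟩, h3.2, h2.2⟩, by simp⟩
  · omega
  · exact ⟨y, v, x, ⟨⟨h2.1, h1.1⟩, h1.2, h2.2⟩, by simp⟩
  · exact ⟨x, v, y, ⟨⟨h1.1, h2.1⟩, h2.2, h1.2⟩, by simp⟩
  · omega
  · exact ⟨x, y, v, ⟨⟨h3.1, h2.1⟩, h2.2, h3.2⟩, by simp⟩
  · exact ⟨y, x, v, ⟨⟨h3.1, h1.1⟩, h1.2, h3.2⟩, by simp⟩

theorem treeCount_eq_one [DecidableEq V] (hq : q.Injective) (hp : p.Injective)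
    (hS : CutConnected q p S)
    (h321 : ∀ x y z, ¬ Is321 q p x y z) (h3412 : ∀ x y z w, ¬ Is3412 q p x y z w) :
    treeCount q p S = 1 := by
  rcases S.eq_empty_or_nonempty with rfl | ⟨x, hx⟩
  · exact treeCount_empty
  refine (hS.induction_on (P := fun T => CutConnected q p T ∧ treeCount q p T = 1)
    (Finset.singleton_subset_iff.2 hx) (Finset.singleton_nonempty x)
    ⟨cutConnected_singleton x, treeCount_singleton x⟩ ?_).2
  rintro T - - ⟨hT, hT1⟩ v - hv u hu huv
  refine ⟨hT.insert_of_adj hu huv, ?_⟩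
  rw [treeCount_insert_of_unique_adj hq hp hv hu huv, hT1]
  intro w hw hvw
  refine eq_of_adj_of_adj hq hp hT hv hw hu (fun x y h1 h2 h3 => ?_) h3412 hvw huv
  obtain ⟨i, j, k, h, -⟩ := exists_is321_of_triangle h1 h2 h3
  exact h321 i j k h

theorem cutConnected_triangle [DecidableEq V] {i j k : V} (h : Is321 q p i j k) :
    CutConnected q p {j, i, k} :=
  ((cutConnected_singleton k).insert_of_adj (u := k) (by simp)
    (Or.inl ⟨by have := h.1; omega, by have := h.2; omega⟩)).insert_of_adj (u := k) (by simp)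
    (Or.inl ⟨h.1.2, h.2.1⟩)

/-- Growth starts at the triangle. A triangle through a vertex added later would be a second 321, so
each added vertex has exactly one neighbour. -/
theorem treeCount_eq_two [DecidableEq V] (hq : q.Injective) (hp : p.Injective)
    (hS : CutConnected q p S) {i j k : V} (hi : i ∈ S) (hj : j ∈ S) (hk : k ∈ S)
    (hijk : Is321 q p i j k)
    (h321 : ∀ x y z, Is321 q p x y z → x = i ∧ y = j ∧ z = k)
    (h3412 : ∀ x y z w, ¬ Is3412 q p x y z w) : treeCount q p S = 2 := by
  refine (hS.induction_on (P := fun T => CutConnected q p T ∧ treeCount q p T = 2)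
    (S₀ := {j, i, k}) (by simp [Finset.insert_subset_iff, hi, hj, hk]) ⟨j, by simp⟩
    ⟨cutConnected_triangle hijk, treeCount_triangle hq hp hijk.1.1 hijk.1.2 hijk.2.1 hijk.2.2⟩ ?_).2
  rintro T h0 - ⟨hT, hT1⟩ v - hv u hu huv
  refine ⟨hT.insert_of_adj hu huv, ?_⟩
  rw [treeCount_insert_of_unique_adj hq hp hv hu huv, hT1]
  intro w hw hvw
  refine eq_of_adj_of_adj hq hp hT hv hw hu (fun x y h1 h2 h3 => ?_) h3412 hvw huv
  obtain ⟨x', y', z', h, hv'⟩ := exists_is321_of_triangle h1 h2 h3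
  obtain ⟨rfl, rfl, rfl⟩ := h321 _ _ _ h
  exact hv (h0 (by simp; tauto))

/-- If the number of trees is at most two, then a pattern `321` in a connected set is unique. -/
theorem is321_unique [DecidableEq V] (hq : q.Injective) (hp : p.Injective)
    (hS : CutConnected q p S) (htwo : treeCount q p S ≤ 2) {i j k : V} (hi : i ∈ S) (hj : j ∈ S)
    (hk : k ∈ S) (hijk : Is321 q p i j k) {x y z : V} (hx : x ∈ S) (hy : y ∈ S) (hz : z ∈ S)
    (hxyz : Is321 q p x y z) : x = i ∧ y = j ∧ z = k := by
  have := (hS.induction_on (P := fun T => CutConnected q p T ∧ (3 ≤ treeCount q p T ∨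
      (2 ≤ treeCount q p T ∧ ∀ x ∈ T, ∀ y ∈ T, ∀ z ∈ T, Is321 q p x y z → x = i ∧ y = j ∧ z = k)))
    (S₀ := {j, i, k}) (by simp [Finset.insert_subset_iff, hi, hj, hk]) ⟨j, by simp⟩
    ⟨cutConnected_triangle hijk, Or.inr
      ⟨(treeCount_triangle hq hp hijk.1.1 hijk.1.2 hijk.2.1 hijk.2.2).ge, ?_⟩⟩ ?_).2
  · rcases this with h | h
    · omega
    · exact h.2 x hx y hy z hz hxyz
  · intro x hx y hy z hz h
    unfold Is321 at h hijk
    simp only [Finset.mem_insert, Finset.mem_singleton] at hx hy hz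
    rcases hx with rfl | rfl | rfl <;> rcases hy with rfl | rfl | rfl <;>
      rcases hz with rfl | rfl | rfl <;> first | exact ⟨rfl, rfl, rfl⟩ | omega
  · rintro T - - ⟨hT, hT1⟩ v - hv u hu huv
    refine ⟨hT.insert_of_adj hu huv, ?_⟩
    -- A second neighbour pushes the count to at least 3; a vertex with only one neighbour lies in
    -- no triangle.
    by_cases hw : ∃ w ∈ T, InvAdj q p v w ∧ u ≠ w
    · obtain ⟨w, hw, hvw, huw⟩ := hw
      have := treeCount_lt_insert hq hp hT hv hu huv hw hvw huw
      left
      rcases hT1 with h | h <;> omega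
    · push Not at hw
      rw [treeCount_insert_of_unique_adj hq hp hv hu huv (fun w hw' h => (hw w hw' h).symm)]
      refine hT1.imp_right fun h => ⟨h.1, fun x hx y hy z hz hxyz => ?_⟩
      have axy : InvAdj q p x y := Or.inl ⟨hxyz.1.1, hxyz.2.2⟩
      have ayz : InvAdj q p y z := Or.inl ⟨hxyz.1.2, hxyz.2.1⟩
      have axz : InvAdj q p x z := Or.inl ⟨hxyz.1.1.trans hxyz.1.2, hxyz.2.1.trans hxyz.2.2⟩
      have hxv : x ≠ v := by
        rintro rfl
        have h1 := hw y (Finset.mem_of_mem_insert_of_ne hy axy.symm.ne) axy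
        have h2 := hw z (Finset.mem_of_mem_insert_of_ne hz axz.symm.ne) axz
        exact ayz.ne (h1.symm.trans h2)
      have hyv : y ≠ v := by
        rintro rfl
        have h1 := hw x (Finset.mem_of_mem_insert_of_ne hx axy.ne) axy.symm
        have h2 := hw z (Finset.mem_of_mem_insert_of_ne hz ayz.symm.ne) ayz
        exact axz.ne (h1.symm.trans h2)
      have hzv : z ≠ v := by
        rintro rfl
        have h1 := hw x (Finset.mem_of_mem_insert_of_ne hx axz.ne) axz.symm
        have h2 := hw y (Finset.mem_of_mem_insert_of_ne hy ayz.ne) ayz.symm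
        exact axy.ne (h1.symm.trans h2)
      exact h.2 x (Finset.mem_of_mem_insert_of_ne hx hxv) y (Finset.mem_of_mem_insert_of_ne hy hyv)
        z (Finset.mem_of_mem_insert_of_ne hz hzv) hxyz

end

/-! ### From grids and permutations to trees and inversion graphs -/

section Permutation

variable {n : ℕ} (π : Equiv.Perm (Fin n))

/-- The values of a permutation as natural numbers. -/
def permVal (i : Fin n) : ℕ := π i

theorem permVal_injective : (permVal π).Injective :=
  fun _ _ h => π.injective (Fin.val_injective h)

/-- Pairs of columns correspond to cells of the grid. -/
def cellEquiv : Finset (Fin n × Fin n) ≃ GridFilling n n :=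
  ((Equiv.refl (Fin n)).prodCongr π).finsetCongr

theorem mem_cellEquiv {T : Finset (Fin n × Fin n)} {c r : Fin n} :
    (c, r) ∈ cellEquiv π T ↔ (c, π.symm r) ∈ T := by
  simp [cellEquiv, Equiv.finsetCongr_apply, Finset.mem_map_equiv]

theorem mem_cellEquiv_apply {T : Finset (Fin n × Fin n)} {i j : Fin n} :
    (i, π j) ∈ cellEquiv π T ↔ (i, j) ∈ T := by
  rw [mem_cellEquiv, Equiv.symm_apply_apply]

/-- The last dot of a row has nothing to its right, so by completeness it is a leaf, and likewise
for columns. This bounds every dot by the leaves of its row and column and replaces the completeness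
condition. -/
theorem isTreeOn_of_mem_cnatSet {T : Finset (Fin n × Fin n)} (h : cellEquiv π T ∈ cnatSet π) :
    IsTreeOn Fin.val (permVal π) Finset.univ T := by
  obtain ⟨hT, hleaf⟩ := h
  refine ⟨fun _ => Finset.mem_univ _, fun _ => Finset.mem_univ _, ?_, ?_, ?_, ?_⟩
  · intro i j hij
    obtain ⟨c, hc, hmax⟩ := (Finset.univ.filter (fun c => (c, π j) ∈ cellEquiv π T)).exists_max_image
      id ⟨i, by simpa [mem_cellEquiv_apply] using hij⟩
    simp only [Finset.mem_filter, Finset.mem_univ, true_and, id] at hc hmax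
    have hnr : ¬ (cellEquiv π T).HasDotRight (c, π j) := by
      rintro ⟨c', hlt, hc'⟩
      exact absurd (hmax c' hc') (not_le.2 hlt)
    have hl := (hleaf (c, π j)).1 ⟨hc, (hT.complete _ hc).elim (fun h => absurd h.2 hnr) id⟩
    have hjc : j = c := π.injective hl
    subst hjc
    exact hmax i ((mem_cellEquiv_apply π).2 hij)
  · intro i j hij
    obtain ⟨r, hr, hmax⟩ := (Finset.univ.filter (fun r => (i, r) ∈ cellEquiv π T)).exists_max_image
      id ⟨π j, by simpa [mem_cellEquiv_apply] using hij⟩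
    simp only [Finset.mem_filter, Finset.mem_univ, true_and, id] at hr hmax
    have hnr : ¬ (cellEquiv π T).HasDotBelow (i, r) := by
      rintro ⟨r', hlt, hr'⟩
      exact absurd (hmax r' hr') (not_le.2 hlt)
    have hl := (hleaf (i, r)).1 ⟨hr, (hT.complete _ hr).elim (fun h => absurd h.1 hnr) id⟩
    simp only at hl
    subst hl
    exact hmax (π j) ((mem_cellEquiv_apply π).2 hij)
  · intro i _
    exact (mem_cellEquiv_apply π).1 ((hleaf (i, π i)).2 rfl).1
  · intro i j hij hnr
    have := hT.unique_parent (i, π j) ((mem_cellEquiv_apply π).2 hij) (fun hh => hnr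
      ⟨fun x _ => by rw [show (i : ℕ) = 0 from hh.1]; exact Nat.zero_le _,
        fun x _ => by rw [show permVal π j = 0 from hh.2]; exact Nat.zero_le _⟩)
    refine Xor.of_iff this ⟨?_, ?_⟩ ⟨?_, ?_⟩
    · rintro ⟨k, hk, hik⟩
      exact ⟨π k, hk, (mem_cellEquiv_apply π).2 hik⟩
    · rintro ⟨r, hr, hir⟩
      refine ⟨π.symm r, ?_, (mem_cellEquiv π).1 hir⟩
      simpa [permVal] using hr
    · rintro ⟨k, hk, hkj⟩
      exact ⟨k, hk, (mem_cellEquiv_apply π).2 hkj⟩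
    · rintro ⟨k, hk, hkj⟩
      exact ⟨k, hk, (mem_cellEquiv_apply π).1 hkj⟩

theorem mem_cnatSet_of_isTreeOn {T : Finset (Fin n × Fin n)}
    (h : IsTreeOn Fin.val (permVal π) Finset.univ T) : cellEquiv π T ∈ cnatSet π := by
  have hpos : ∀ {c r}, (c, r) ∈ cellEquiv π T → c ≤ π.symm r := fun hcr =>
    h.pos_le ((mem_cellEquiv π).1 hcr)
  have hval : ∀ {c r}, (c, r) ∈ cellEquiv π T → r ≤ π c := fun hcr => by
    have := h.val_le ((mem_cellEquiv π).1 hcr)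
    simpa [permVal] using this
  have hleaf : ∀ c, (c, π c) ∈ cellEquiv π T := fun c =>
    (mem_cellEquiv_apply π).2 (h.leaf_mem (Finset.mem_univ c))
  have hnb : ∀ c, ¬ (cellEquiv π T).HasDotBelow (c, π c) := by
    rintro c ⟨r, hr, hcr⟩
    exact absurd (hval hcr) (not_le.2 hr)
  have hnr : ∀ c, ¬ (cellEquiv π T).HasDotRight (c, π c) := by
    rintro c ⟨c', hc, hcr⟩
    have := hpos hcr
    simp only [Equiv.symm_apply_apply] at this
    exact absurd this (not_le.2 hc)
  have hb : ∀ {c r}, (c, r) ∈ cellEquiv π T → r ≠ π c → (cellEquiv π T).HasDotBelow (c, r) :=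
    fun hcr hne => ⟨_, lt_of_le_of_ne (hval hcr) hne, hleaf _⟩
  have hr : ∀ {c r}, (c, r) ∈ cellEquiv π T → r ≠ π c → (cellEquiv π T).HasDotRight (c, r) :=
    fun {c r} hcr hne => ⟨π.symm r, lt_of_le_of_ne (hpos hcr) (fun hh => hne ((Equiv.eq_symm_apply π).1 hh).symm), by
      simpa using hleaf (π.symm r)⟩
  refine ⟨⟨⟨fun r => ⟨π.symm r, by simpa using hleaf (π.symm r)⟩, fun c => ⟨π c, hleaf c⟩, ?_⟩, ?_⟩,
    ?_⟩
  · rintro ⟨c, r⟩ hcr hne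
    obtain ⟨j, rfl⟩ := π.surjective r
    have hn : 0 < n := c.pos
    have := h.parent ((mem_cellEquiv_apply π).1 hcr) (fun hh => hne
      ⟨Nat.le_zero.1 (hh.1 ⟨0, hn⟩ (Finset.mem_univ _)), Nat.le_zero.1 (by
        simpa [permVal] using hh.2 (π.symm ⟨0, hn⟩) (Finset.mem_univ _))⟩)
    refine Xor.of_iff this ⟨?_, ?_⟩ ⟨?_, ?_⟩
    · rintro ⟨r, hr, hir⟩
      refine ⟨π.symm r, ?_, (mem_cellEquiv π).1 hir⟩
      simpa [permVal] using hr
    · rintro ⟨k, hk, hik⟩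
      exact ⟨π k, hk, (mem_cellEquiv_apply π).2 hik⟩
    · rintro ⟨k, hk, hkj⟩
      exact ⟨k, hk, (mem_cellEquiv_apply π).1 hkj⟩
    · rintro ⟨k, hk, hkj⟩
      exact ⟨k, hk, (mem_cellEquiv_apply π).2 hkj⟩
  · rintro ⟨c, r⟩ hcr
    by_cases hne : r = π c
    · subst hne
      exact Or.inr ⟨hnb c, hnr c⟩
    · exact Or.inl ⟨hb hcr hne, hr hcr hne⟩
  · rintro ⟨c, r⟩
    constructor
    · rintro ⟨hcr, h1, -⟩
      by_contra hne
      exact h1 (hb hcr hne)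
    · intro hcr
      simp only at hcr
      subst hcr
      exact ⟨hleaf c, hnb c, hnr c⟩

theorem cnat_eq_treeCount : cnat π = treeCount Fin.val (permVal π) Finset.univ := by
  have : cnatSet π = cellEquiv π '' (treesOn Fin.val (permVal π) Finset.univ : Set _) := by
    ext T
    obtain ⟨T, rfl⟩ := (cellEquiv π).surjective T
    rw [(cellEquiv π).injective.mem_set_image, Finset.mem_coe, mem_treesOn]
    exact ⟨isTreeOn_of_mem_cnatSet π, mem_cnatSet_of_isTreeOn π⟩
  rw [cnat, this, Set.ncard_image_of_injective _ (cellEquiv π).injective, Set.ncard_coe_finset]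
  rfl

variable {π}

/-- Take the side of the cut that contains position 0 and the first position `y` missing from it. If
no edge crosses, each earlier letter is smaller than all letters from `y` on, by comparison through
`y` when needed, so the first `y` letters form a permutation of themselves. -/
theorem PermIrreducible.cutConnected (hπ : PermIrreducible π) :
    CutConnected Fin.val (permVal π) Finset.univ := by
  have main : ∀ X : Finset (Fin n), ∀ y, y ∉ X → (∀ i < y, i ∈ X) → 0 < (y : ℕ) →
      ∃ x ∈ X, ∃ y ∉ X, InvAdj Fin.val (permVal π) x y := by
    intro X y hy hyX hy0
    by_contra! hcon
    have hno : ∀ {x z}, x ∈ X → z ∉ X → x < z → π x < π z := by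
      intro x z hx hz hxz
      by_contra hle
      exact hcon x hx z hz (Or.inl ⟨hxz, lt_of_le_of_ne (not_lt.1 hle)
        ((permVal_injective π).ne hxz.ne')⟩)
    have hno' : ∀ {x z}, x ∈ X → z ∉ X → z < x → π z < π x := by
      intro x z hx hz hxz
      by_contra hle
      exact hcon x hx z hz (Or.inr ⟨hxz, lt_of_le_of_ne (not_lt.1 hle)
        ((permVal_injective π).ne hxz.ne')⟩)
    refine hπ ⟨y, hy0, y.isLt, fun i hi => ?_⟩
    have hiX := hyX i hi
    have hlow : ∀ z, y ≤ z → π i < π z := by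
      intro z hz
      by_cases hzX : z ∈ X
      · exact (hno hiX hy hi).trans (hno' hzX hy (lt_of_le_of_ne hz (fun hh => hy (hh ▸ hzX))))
      · exact hno hiX hzX (lt_of_lt_of_le hi hz)
    -- All `π i + 1` letters up to `π i` sit before `y`; counting them gives `π i < y`.
    have hsub : (Finset.Iic (π i)).map π.symm.toEmbedding ⊆ Finset.Iio y := by
      intro z hz
      rw [Finset.mem_map_equiv, Equiv.symm_symm, Finset.mem_Iic] at hz
      rw [Finset.mem_Iio]
      by_contra hle
      exact absurd (hlow z (not_lt.1 hle)) (not_lt.2 hz)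
    have := Finset.card_le_card hsub
    rw [Finset.card_map, Fin.card_Iic, Fin.card_Iio] at this
    omega
  have min_notMem : ∀ X : Finset (Fin n), X ≠ Finset.univ → ∃ y, y ∉ X ∧ ∀ i < y, i ∈ X := by
    intro X hX
    have hne : Xᶜ.Nonempty := by
      rw [Finset.nonempty_iff_ne_empty, Ne, Finset.compl_eq_empty_iff]
      exact hX
    refine ⟨Xᶜ.min' hne, Finset.mem_compl.1 (Finset.min'_mem _ _), fun i hi => ?_⟩
    by_contra hiX
    exact absurd (Finset.min'_le _ i (Finset.mem_compl.2 hiX)) (not_le.2 hi)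
  intro X _ hne hX
  obtain ⟨y, hy, hyX⟩ := min_notMem X hX
  rcases Nat.eq_zero_or_pos (y : ℕ) with h0 | h0
  · obtain ⟨z, hz, hzX⟩ := min_notMem Xᶜ (by
      rw [Ne, Finset.compl_eq_univ_iff]
      exact hne.ne_empty)
    have hz0 : 0 < (z : ℕ) := by
      rcases Nat.eq_zero_or_pos (z : ℕ) with hz0 | hz0
      · have : z = y := Fin.ext (by omega)
        subst this
        exact absurd (Finset.mem_compl.2 hy) hz
      · exact hz0
    obtain ⟨x, hx, w, hw, hxw⟩ := main Xᶜ z hz hzX hz0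
    exact ⟨w, by simpa using hw, x, Finset.mem_univ _, Finset.mem_compl.1 hx, hxw.symm⟩
  · obtain ⟨x, hx, w, hw, hxw⟩ := main X y hy hyX h0
    exact ⟨x, hx, w, Finset.mem_univ _, hw, hxw⟩

theorem isPatternOccurrence_321_iff {f : Fin 3 ↪o Fin n} :
    IsPatternOccurrence π ![3, 2, 1] f ↔ Is321 Fin.val (permVal π) (f 0) (f 1) (f 2) := by
  have h1 : f 0 < f 1 := f.strictMono (by decide)
  have h2 : f 1 < f 2 := f.strictMono (by decide)
  constructor
  · intro h
    exact ⟨⟨h1, h2⟩, (h 2 1).2 (by decide), (h 1 0).2 (by decide)⟩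
  · rintro ⟨-, h3, h4⟩
    have h3' : π (f 2) < π (f 1) := h3
    have h4' : π (f 1) < π (f 0) := h4
    intro a b
    fin_cases a <;> fin_cases b <;> simp [h3', h4', h3'.trans h4', h3'.le, h4'.le, (h3'.trans h4').le]

theorem exists_isPatternOccurrence_321 {i j k : Fin n} (h : Is321 Fin.val (permVal π) i j k) :
    ∃ f : Fin 3 ↪o Fin n, IsPatternOccurrence π ![3, 2, 1] f ∧ f 0 = i ∧ f 1 = j ∧ f 2 = k := by
  have h1 : i < j := h.1.1
  have h2 : j < k := h.1.2
  refine ⟨OrderEmbedding.ofStrictMono ![i, j, k] ?_, ?_, rfl, rfl, rfl⟩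
  · rw [Fin.strictMono_iff_lt_succ]
    intro a
    fin_cases a
    · exact h1
    · exact h2
  · rw [isPatternOccurrence_321_iff]
    exact h

theorem avoidsPattern_3412_iff :
    AvoidsPattern π ![3, 4, 1, 2] ↔ ∀ x y z w, ¬ Is3412 Fin.val (permVal π) x y z w := by
  constructor
  · rintro h x y z w ⟨⟨h1, h2, h3⟩, h4, h5, h6⟩
    refine h ⟨OrderEmbedding.ofStrictMono ![x, y, z, w] ?_, ?_⟩
    · rw [Fin.strictMono_iff_lt_succ]
      intro a
      fin_cases a
      · exact h1
      · exact h2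
      · exact h3
    · have h4' : π z < π w := h4
      have h5' : π w < π x := h5
      have h6' : π x < π y := h6
      have h7 := h4'.trans h5'
      have h8 := h5'.trans h6'
      have h9 := h7.trans h6'
      intro a b
      fin_cases a <;> fin_cases b <;>
        simp [h4', h5', h6', h7, h8, h9, h4'.le, h5'.le, h6'.le, h7.le, h8.le, h9.le]
  · rintro h ⟨f, hf⟩
    exact h (f 0) (f 1) (f 2) (f 3) ⟨⟨f.strictMono (by decide), f.strictMono (by decide),
      f.strictMono (by decide)⟩, (hf 2 3).2 (by decide), (hf 3 0).2 (by decide),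
      (hf 0 1).2 (by decide)⟩

/-! ### Fixed points -/

/-- A letter is a fixed point if and only if there are as many larger letters to the left as
smaller letters to the right. -/
theorem apply_eq_self_iff_card (x : Fin n) : π x = x ↔
    (Finset.univ.filter (fun y => y < x ∧ π x < π y)).card =
      (Finset.univ.filter (fun y => x < y ∧ π y < π x)).card := by
  have hL : (Finset.univ.filter (fun y => y < x ∧ π x < π y)) =
      Finset.Iio x \ (Finset.Iio (π x)).map π.symm.toEmbedding := by
    ext y
    simp only [Finset.mem_filter, Finset.mem_univ, true_and, Finset.mem_sdiff, Finset.mem_Iio,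
      Finset.mem_map_equiv, Equiv.symm_symm, not_lt]
    exact and_congr_right fun h => (π.injective.ne h.ne').le_iff_lt.symm
  have hR : (Finset.univ.filter (fun y => x < y ∧ π y < π x)) =
      (Finset.Iio (π x)).map π.symm.toEmbedding \ Finset.Iio x := by
    ext y
    simp only [Finset.mem_filter, Finset.mem_univ, true_and, Finset.mem_sdiff, Finset.mem_Iio,
      Finset.mem_map_equiv, Equiv.symm_symm, not_lt]
    rw [and_comm]
    exact and_congr_right fun h => (Ne.le_iff_lt (fun hh => h.ne (by rw [hh]))).symm
  -- The positions before `x` and the positions of letters below `π x` number `x` and `π x`; these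
  -- agree exactly when the two set differences have equal size.
  have h1 := Finset.card_sdiff_add_card_inter (Finset.Iio x)
    ((Finset.Iio (π x)).map π.symm.toEmbedding)
  have h2 := Finset.card_sdiff_add_card_inter ((Finset.Iio (π x)).map π.symm.toEmbedding)
    (Finset.Iio x)
  rw [Finset.inter_comm] at h2
  rw [Finset.card_map, Fin.card_Iio] at h2
  rw [Fin.card_Iio] at h1
  rw [hL, hR, Fin.ext_iff]
  omega

theorem middle_fixed_of_unique {i j k : Fin n} (hijk : Is321 Fin.val (permVal π) i j k)
    (huniq : ∀ x y z, Is321 Fin.val (permVal π) x y z → x = i ∧ y = j ∧ z = k) : π j = j := by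
  obtain ⟨⟨h1, h2⟩, h3, h4⟩ := hijk
  rw [apply_eq_self_iff_card]
  have hL : (Finset.univ.filter (fun y => y < j ∧ π j < π y)) = {i} := by
    refine Finset.eq_singleton_iff_unique_mem.2 ⟨by simpa using ⟨h1, h4⟩, fun y hy => ?_⟩
    simp only [Finset.mem_filter, Finset.mem_univ, true_and] at hy
    exact (huniq y j k ⟨⟨hy.1, h2⟩, h3, hy.2⟩).1
  have hR : (Finset.univ.filter (fun y => j < y ∧ π y < π j)) = {k} := by
    refine Finset.eq_singleton_iff_unique_mem.2 ⟨by simpa using ⟨h2, h3⟩, fun y hy => ?_⟩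
    simp only [Finset.mem_filter, Finset.mem_univ, true_and] at hy
    exact (huniq i j y ⟨⟨h1, hy.1⟩, hy.2, h4⟩).2.2
  rw [hL, hR, Finset.card_singleton, Finset.card_singleton]

/-- A fixed point of an irreducible permutation is the middle of a pattern `321`. -/
theorem PermIrreducible.exists_is321_of_fixed (hπ : PermIrreducible π) (hn : 1 < n) {x : Fin n}
    (hx : π x = x) : ∃ y z, Is321 Fin.val (permVal π) y x z := by
  have hcard := (apply_eq_self_iff_card x).1 hx
  rcases (Finset.univ.filter (fun y => y < x ∧ π x < π y)).eq_empty_or_nonempty with he | ⟨y, hy⟩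
  · refine absurd ?_ hπ
    have hlow : ∀ i < x, π i < x := by
      intro i hi
      by_contra hle
      have hlt : π x < π i := by
        rw [hx]
        exact lt_of_le_of_ne (not_lt.1 hle) (fun hh => hi.ne (π.injective (hh.symm.trans hx.symm)))
      have : i ∈ Finset.univ.filter (fun y => y < x ∧ π x < π y) := by simp [hi, hlt]
      rw [he] at this
      exact Finset.notMem_empty _ this
    -- The first `x` letters are permuted among themselves. For `x = 0` this prefix is empty, and
    -- the prefix of length 1 is used, which is proper because `1 < n`.
    rcases Nat.eq_zero_or_pos (x : ℕ) with h0 | h0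
    · refine ⟨1, le_rfl, hn, fun i hi => ?_⟩
      have : i = x := Fin.ext (by omega)
      rw [this, hx, h0]
      exact Nat.one_pos
    · exact ⟨x, h0, x.isLt, fun i hi => hlow i hi⟩
  · obtain ⟨z, hz⟩ := Finset.card_pos.1 (hcard ▸ Finset.card_pos.2 ⟨y, hy⟩)
    simp only [Finset.mem_filter, Finset.mem_univ, true_and] at hy hz
    exact ⟨y, z, ⟨hy.1, hz.1⟩, hz.2, hy.2⟩

end Permutation

theorem mainTheorem11 {n : ℕ} (π : Equiv.Perm (Fin n)) (hπ : PermIrreducible π) :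
    (cnat π = 2 ↔
      (∃! f : Fin 3 ↪o Fin n, IsPatternOccurrence π ![3, 2, 1] f) ∧
        AvoidsPattern π ![3, 4, 1, 2]) ∧
    (∀ f : Fin 3 ↪o Fin n, IsPatternOccurrence π ![3, 2, 1] f →
      (∀ g : Fin 3 ↪o Fin n, IsPatternOccurrence π ![3, 2, 1] g → g = f) →
      π (f 1) = f 1 ∧ ∀ x : Fin n, π x = x → x = f 1) := by
  have hq : (Fin.val : Fin n → ℕ).Injective := Fin.val_injective
  have hp := permVal_injective π
  have hS := hπ.cutConnected
  have huniq : ∀ f : Fin 3 ↪o Fin n,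
      (∀ g : Fin 3 ↪o Fin n, IsPatternOccurrence π ![3, 2, 1] g → g = f) →
      ∀ x y z, Is321 Fin.val (permVal π) x y z → x = f 0 ∧ y = f 1 ∧ z = f 2 := by
    intro f hf x y z h
    obtain ⟨g, hg, rfl, rfl, rfl⟩ := exists_isPatternOccurrence_321 h
    rw [hf g hg]
    exact ⟨rfl, rfl, rfl⟩
  refine ⟨?_, ?_⟩
  · rw [cnat_eq_treeCount, avoidsPattern_3412_iff]
    constructor
    · intro h
      have h3412 : ∀ x y z w, ¬ Is3412 Fin.val (permVal π) x y z w := by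
        intro x y z w hh
        have h1 := three_le_treeCount_of_is3412 hq hp hh
        have h2 := treeCount_mono hq hp hS (Finset.subset_univ {y, x, z, w}) ⟨y, by simp⟩
        omega
      refine ⟨?_, h3412⟩
      have : ∃ i j k, Is321 Fin.val (permVal π) i j k := by
        by_contra! hcon
        rw [treeCount_eq_one hq hp hS hcon h3412] at h
        omega
      obtain ⟨i, j, k, hijk⟩ := this
      obtain ⟨f, hf, rfl, rfl, rfl⟩ := exists_isPatternOccurrence_321 hijk
      refine ⟨f, hf, fun g hg => ?_⟩
      obtain ⟨h0, h1, h2⟩ := is321_unique hq hp hS h.le (Finset.mem_univ _) (Finset.mem_univ _)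
        (Finset.mem_univ _) hijk (Finset.mem_univ _) (Finset.mem_univ _) (Finset.mem_univ _)
        (isPatternOccurrence_321_iff.1 hg)
      ext a
      fin_cases a
      · exact congrArg Fin.val h0
      · exact congrArg Fin.val h1
      · exact congrArg Fin.val h2
    · rintro ⟨⟨f, hf, hf'⟩, h3412⟩
      exact treeCount_eq_two hq hp hS (Finset.mem_univ _) (Finset.mem_univ _) (Finset.mem_univ _)
        (isPatternOccurrence_321_iff.1 hf) (huniq f hf') h3412
  · intro f hf hf'
    have h321 := isPatternOccurrence_321_iff.1 hf
    refine ⟨middle_fixed_of_unique h321 (huniq f hf'), fun x hx => ?_⟩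
    have h01 : f 0 < f 1 := h321.1.1
    obtain ⟨y, z, h⟩ := hπ.exists_is321_of_fixed (by have := (f 1).isLt; omega) hx
    exact (huniq f hf' y x z h).2.1
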